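/- Let $(N,g)$ be a smooth $n$-dimensional Riemannian manifold with Levi-Civita connection $\nabla$ (in particular $n\ge 3$ is allowed; no restriction on $n$ is needed), $B$ a two-form of class $C^1$ on $N$ and $V\colon N\to\mathbb{R}$ a function of class $C^1$. Let $M=\mathbb{R}^{1,1}$ be two-dimensional Minkowski space with global coordinates $(t,x)$, metric $h=dt^2-dx^2$ and volume measure $d\mu=dt\,dx$. Let $k\in\{2,3,\dots\}\cup\{\infty\}$. For a $C^k$ map $\phi\colon M\to N$ and a compact set $K\subset M$ put $$S_K(\phi)=\int_K\Big(\tfrac12|d\phi|^2+\phi^*B+V(\phi)\Big)\,d\mu,$$ where $|d\phi|^2=|d\phi(\partial_t)|_g^2-|d\phi(\partial_x)|_g^2$ and the two-form $\phi^*B$ is identified with the function $B(d\phi(\partial_t),d\phi(\partial_x))$. Call $\phi$ a critical point of $S(\phi)=\int_M\big(\tfrac12|d\phi|^2+\phi^*B+V(\phi)\big)\,d\mu$ if $$\frac{d}{ds}\Big|_{s=0}S_K(\phi_s)=0$$ for every $C^k$ family $(\phi_s)_{s\in\mathbb{R}}$ of maps $M\to N$ (jointly $C^k$ in $s$ and the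 point of $M$) with $\phi_0=\phi$ and every compact $K\subset M$ such that $\phi_s=\phi$ outside $K$ for all $s$. **Proposition (Euler–Lagrange equation).** A $C^k$ map $\phi\colon M\to N$ is a critical point of $S$ if and only if $$\tau(\phi)=Z\big(d\phi(\partial_t)\wedge d\phi(\partial_x)\big)+\nabla V(\phi)$$ at every point of $M$. Here $\tau(\phi)=\operatorname{Tr}_h\big(\nabla^{\phi^*TN}d\phi\big)=\nabla^{\phi^*TN}_{\partial_t}d\phi(\partial_t)-\nabla^{\phi^*TN}_{\partial_x}d\phi(\partial_x)$ is the wave map operator, $\nabla V$ is the gradient of $V$, and the vector bundle homomorphism $Z\colon\Lambda^2TN\to TN$ is defined by $$\langle Z(\xi_1\wedge\xi_2),\eta\rangle=dB(\eta,\xi_1,\xi_2)\qquad\text{for }\eta,\xi_1,\xi_2\in T_yN,\ y\in N.$$ -/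

import Mathlib

open scoped Manifold ContDiff

noncomputable section

namespace StringAction

/-! ### Two-dimensional Minkowski space -/

/-- Two-dimensional Minkowski space `ℝ^{1,1}`, with global coordinates `(t, x)`. Its volume measure
is the Lebesgue measure `dt dx`. -/
abbrev Mink : Type := ℝ × ℝ

/-- The Minkowski metric `h = dt² - dx²`, of signature `(+,-)`. -/
def minkMetric (v w : Mink) : ℝ := v.1 * w.1 - v.2 * w.2

/-- The coordinate vector field `∂_t`. -/
def dt : Mink := (1, 0)

/-- The coordinate vector field `∂_x`. -/
def dx : Mink := (0, 1)

/-- The global orthonormal frame `(∂_t, ∂_x)` of Minkowski space. -/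
def minkFrame : Fin 2 → Mink := ![dt, dx]

section Target

variable {n : ℕ} {N : Type*} [TopologicalSpace N] [ChartedSpace (EuclideanSpace ℝ (Fin n)) N]
  [IsManifold (𝓡 n) ∞ N]

/-! ### Musical isomorphism -/

/-- Every covector at `y` is represented by a unique tangent vector, by means of the metric. -/
theorem existsUnique_sharp
    (g : Bundle.ContMDiffRiemannianMetric (𝓡 n) ∞ (EuclideanSpace ℝ (Fin n))
      (fun y : N => TangentSpace (𝓡 n) y))
    (y : N) (α : TangentSpace (𝓡 n) y →ₗ[ℝ] ℝ) :
    ∃! ξ : TangentSpace (𝓡 n) y, ∀ η, g.inner y ξ η = α η := by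
  have : FiniteDimensional ℝ (TangentSpace (𝓡 n) y) :=
    inferInstanceAs (FiniteDimensional ℝ (EuclideanSpace ℝ (Fin n)))
  let L : TangentSpace (𝓡 n) y →ₗ[ℝ] Module.Dual ℝ (TangentSpace (𝓡 n) y) :=
    { toFun := fun ξ => (g.inner y ξ).toLinearMap
      map_add' := fun a b => by ext; simp
      map_smul' := fun a b => by ext; simp }
  have hinj : Function.Injective L := by
    rw [← LinearMap.ker_eq_bot, LinearMap.ker_eq_bot']
    intro ξ hξ
    by_contra hne
    have h1 := g.pos y ξ hne
    have h2 : g.inner y ξ ξ = 0 := LinearMap.congr_fun hξ ξ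
    exact h1.ne' h2
  have hsurj : Function.Surjective L :=
    (LinearMap.injective_iff_surjective_of_finrank_eq_finrank
      (Subspace.dual_finrank_eq (K := ℝ) (V := TangentSpace (𝓡 n) y)).symm).1 hinj
  obtain ⟨ξ, hξ⟩ := hsurj α
  exact ⟨ξ, fun η => LinearMap.congr_fun hξ η,
    fun ξ' h' => hinj (by rw [hξ]; exact LinearMap.ext h')⟩

variable (g : Bundle.ContMDiffRiemannianMetric (𝓡 n) ∞ (EuclideanSpace ℝ (Fin n))
      (fun y : N => TangentSpace (𝓡 n) y))

/-- The vector `α^♯` with `⟨α^♯, η⟩ = α(η)` for all `η`. -/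
def sharp (y : N) (α : TangentSpace (𝓡 n) y →ₗ[ℝ] ℝ) : TangentSpace (𝓡 n) y :=
  (existsUnique_sharp g y α).choose

theorem inner_sharp (y : N) (α : TangentSpace (𝓡 n) y →ₗ[ℝ] ℝ) (η : TangentSpace (𝓡 n) y) :
    g.inner y (sharp g y α) η = α η :=
  (existsUnique_sharp g y α).choose_spec.1 η

theorem eq_sharp (y : N) (α : TangentSpace (𝓡 n) y →ₗ[ℝ] ℝ) (ξ : TangentSpace (𝓡 n) y)
    (h : ∀ η, g.inner y ξ η = α η) : ξ = sharp g y α :=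
  (existsUnique_sharp g y α).choose_spec.2 ξ h

/-- The gradient `∇V = (dV)^♯` of a function. -/
def gradient (V : N → ℝ) (y : N) : TangentSpace (𝓡 n) y :=
  sharp g y (mvfderiv (𝓡 n) V y).toLinearMap

/-! ### Coordinates -/

/-- The differential at the coordinate point `z` of the inverse of the chart around `y`, that is
the coordinate frame `a ↦ a^i ∂_{y^i}`. -/
def chartFrame (y : N) (z : EuclideanSpace ℝ (Fin n)) :
    EuclideanSpace ℝ (Fin n) →L[ℝ] TangentSpace (𝓡 n) ((extChartAt (𝓡 n) y).symm z) :=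
  (mfderiv 𝓘(ℝ, EuclideanSpace ℝ (Fin n)) (𝓡 n) (extChartAt (𝓡 n) y).symm z).comp
    (NormedSpace.fromTangentSpace z).symm.toContinuousLinearMap

/-- The differential at `y` of the chart around `y`. -/
def chartDeriv (y : N) : TangentSpace (𝓡 n) y →L[ℝ] EuclideanSpace ℝ (Fin n) :=
  mvfderiv (𝓡 n) (extChartAt (𝓡 n) y) y

/-! ### Two-forms -/

variable (n N) in
/-- A (not necessarily continuous) two-form on `N`. -/
abbrev TwoForm : Type _ := ∀ y : N, TangentSpace (𝓡 n) y [⋀^Fin 2]→L[ℝ] ℝ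

/-- The expression of a two-form in the chart around `y`. -/
def TwoForm.coord (B : TwoForm n N) (y : N) (z : EuclideanSpace ℝ (Fin n)) :
    EuclideanSpace ℝ (Fin n) [⋀^Fin 2]→L[ℝ] ℝ :=
  (B ((extChartAt (𝓡 n) y).symm z)).compContinuousLinearMap (chartFrame y z)

/-- A two-form is of class `C^r` if its coordinate expressions are. -/
def TwoForm.IsOfClass (r : ℕ∞) (B : TwoForm n N) : Prop :=
  ∀ y : N, ContDiffOn ℝ r (B.coord y) (extChartAt (𝓡 n) y).target

/-- The exterior derivative `dB` of a two-form, computed in the chart around each point. -/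
def TwoForm.d (B : TwoForm n N) (y : N) : TangentSpace (𝓡 n) y [⋀^Fin 3]→L[ℝ] ℝ :=
  (extDeriv (B.coord y) (extChartAt (𝓡 n) y y)).compContinuousLinearMap (chartDeriv y)

theorem cons_update_aux {T : Type*} [dec : DecidableEq (Fin 2)] (η : T) (m : Fin 2 → T) (i : Fin 2)
    (u : T) : (Fin.cons η (Function.update m i u) : Fin 3 → T)
      = Function.update (Fin.cons η m : Fin 3 → T) i.succ u := by
  obtain rfl : dec = instDecidableEqFin 2 := Subsingleton.elim _ _
  exact Fin.cons_update (α := fun _ => T) η m i u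

/-- The alternating map `(ξ₁, ξ₂) ↦ (η ↦ dB(η, ξ₁, ξ₂))^♯`. -/
def Zalt (B : TwoForm n N) (y : N) :
    TangentSpace (𝓡 n) y [⋀^Fin 2]→ₗ[ℝ] TangentSpace (𝓡 n) y where
  toFun ξ := sharp g y
    { toFun := fun η => B.d y (Matrix.vecCons η ξ)
      map_add' := fun a b => (B.d y).toContinuousMultilinearMap.cons_add ξ a b
      map_smul' := fun c a => (B.d y).toContinuousMultilinearMap.cons_smul ξ c a }
  map_update_add' := fun m i u v => by
    symm
    apply eq_sharp
    intro η
    rw [map_add, add_apply, inner_sharp, inner_sharp]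
    simp only [LinearMap.coe_mk, AddHom.coe_mk, Matrix.vecCons]
    rw [cons_update_aux, cons_update_aux, cons_update_aux]
    exact ((B.d y).toContinuousMultilinearMap.map_update_add (Fin.cons η m) i.succ u v).symm
  map_update_smul' := fun m i c u => by
    symm
    apply eq_sharp
    intro η
    rw [map_smul, smul_apply, inner_sharp]
    simp only [LinearMap.coe_mk, AddHom.coe_mk, Matrix.vecCons]
    rw [cons_update_aux, cons_update_aux]
    exact ((B.d y).toContinuousMultilinearMap.map_update_smul (Fin.cons η m) i.succ c u).symm
  map_eq_zero_of_eq' := fun v i j hv hij => by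
    symm
    apply eq_sharp
    intro η
    rw [map_zero, zero_apply]
    exact ((B.d y).map_eq_zero_of_eq (Matrix.vecCons η v) (i := i.succ) (j := j.succ)
      (by simpa using hv) (by simpa using hij)).symm

/-- The vector bundle homomorphism `Z : Λ²TN → TN` with `⟨Z(ξ₁ ∧ ξ₂), η⟩ = dB(η, ξ₁, ξ₂)`. -/
def Z (B : TwoForm n N) (y : N) : ⋀[ℝ]^2 (TangentSpace (𝓡 n) y) →ₗ[ℝ] TangentSpace (𝓡 n) y :=
  exteriorPower.alternatingMapLinearEquiv (Zalt g B y)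

/-- The wedge product `ξ₁ ∧ ξ₂` of two tangent vectors. -/
def wedge {y : N} (ξ₁ ξ₂ : TangentSpace (𝓡 n) y) : ⋀[ℝ]^2 (TangentSpace (𝓡 n) y) :=
  exteriorPower.ιMulti ℝ 2 ![ξ₁, ξ₂]

theorem inner_Z (B : TwoForm n N) (y : N) (η ξ₁ ξ₂ : TangentSpace (𝓡 n) y) :
    g.inner y (Z g B y (wedge ξ₁ ξ₂)) η = B.d y ![η, ξ₁, ξ₂] := by
  simp only [Z, wedge, exteriorPower.alternatingMapLinearEquiv_apply_ιMulti]
  exact inner_sharp g y _ η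

/-! ### The Levi-Civita connection along a map -/

/-- The coordinate expression `g_{ij}` of the metric in the chart around `y`. -/
def metricCoord (y : N) (z : EuclideanSpace ℝ (Fin n)) :
    EuclideanSpace ℝ (Fin n) →L[ℝ] EuclideanSpace ℝ (Fin n) →L[ℝ] ℝ :=
  LinearMap.toContinuousBilinearMap
    (LinearMap.mk₂ ℝ
      (fun a b => g.inner ((extChartAt (𝓡 n) y).symm z) (chartFrame y z a) (chartFrame y z b))
      (fun a b c => by rw [map_add, map_add, add_apply])
      (fun r a b => by rw [map_smul, map_smul, smul_apply])
      (fun a b c => by rw [map_add, map_add])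
      (fun r a b => by rw [map_smul, map_smul]))

/-- The Christoffel symbols of the first kind at `y`, in the chart around `y`:
`c ↦ ½ (∂_a g(b,c) + ∂_b g(a,c) - ∂_c g(a,b))`. -/
def christoffelFirst (y : N) (a b : EuclideanSpace ℝ (Fin n)) :
    EuclideanSpace ℝ (Fin n) →L[ℝ] ℝ :=
  let Dg := fderiv ℝ (metricCoord g y) (extChartAt (𝓡 n) y y)
  (1 / 2 : ℝ) • (Dg a b + Dg b a - (Dg.flip a).flip b)

/-- The Christoffel term `Γ(a, b) = Γ^i_{jk} a^j b^k ∂_{y^i}` of the Levi-Civita connection at `y`,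
in the chart around `y`. -/
def christoffel (y : N) (a b : EuclideanSpace ℝ (Fin n)) : TangentSpace (𝓡 n) y :=
  sharp g y ((christoffelFirst g y a b).comp (chartDeriv y)).toLinearMap

/-- The derivative `dφ(e)` of a map from Minkowski space at `p` in the direction `e`. -/
def pushforward (φ : Mink → N) (p : Mink) (e : Mink) : TangentSpace (𝓡 n) (φ p) :=
  mfderiv 𝓘(ℝ, Mink) (𝓡 n) φ p ((NormedSpace.fromTangentSpace p).symm e)

/-- The pull-back `∇^{φ^*TN}_e W` of the Levi-Civita connection, for a section `W` of `φ^*TN`. In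
the chart around `φ(p)` its components are `∂_e W^i + Γ^i_{jk} (∂_e φ^j) W^k`. -/
def pullbackCovDeriv (φ : Mink → N) (W : ∀ p, TangentSpace (𝓡 n) (φ p)) (p : Mink) (e : Mink) :
    TangentSpace (𝓡 n) (φ p) :=
  (chartDeriv (φ p)).inverse
      (fderiv ℝ (fun q => mvfderiv (𝓡 n) (extChartAt (𝓡 n) (φ p)) (φ q) (W q)) p e)
    + christoffel g (φ p) (chartDeriv (φ p) (pushforward φ p e)) (chartDeriv (φ p) (W p))

/-- The wave map operator `τ(φ) = Tr_h ∇^{φ^*TN} dφ`. The trace over the orthonormal frame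
`(∂_t, ∂_x)` is `∇_{∂_t}(dφ(∂_t)) - ∇_{∂_x}(dφ(∂_x))`, as the frame is parallel. -/
def waveMapOperator (φ : Mink → N) (p : Mink) : TangentSpace (𝓡 n) (φ p) :=
  ∑ α : Fin 2, minkMetric (minkFrame α) (minkFrame α) •
    pullbackCovDeriv g φ (fun q => pushforward φ q (minkFrame α)) p (minkFrame α)

/-! ### The action functional -/

/-- `|dφ|² = h^{αβ} ⟨dφ(e_α), dφ(e_β)⟩`. -/
def normSqDifferential (φ : Mink → N) (p : Mink) : ℝ :=
  ∑ α : Fin 2, minkMetric (minkFrame α) (minkFrame α) *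
    g.inner (φ p) (pushforward φ p (minkFrame α)) (pushforward φ p (minkFrame α))

/-- The function `f` with `φ^*B = f dt ∧ dx`. -/
def pullbackTwoForm (B : TwoForm n N) (φ : Mink → N) (p : Mink) : ℝ :=
  B (φ p) ![pushforward φ p dt, pushforward φ p dx]

/-- The action `∫_K (½ |dφ|² + φ^*B + V(φ))` over a region `K` of Minkowski space. -/
def action (B : TwoForm n N) (V : N → ℝ) (K : Set Mink) (φ : Mink → N) : ℝ :=
  ∫ p in K, ((1 / 2) * normSqDifferential g φ p + pullbackTwoForm B φ p + V (φ p))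

/-- `φ` is a critical point of the action, within the maps of class `C^k`: for every `C^k`
variation `φ_s` of `φ` that is fixed outside a compact set `K`, the derivative of the action of
`φ_s` over `K` vanishes at `s = 0`. (The integral over all of Minkowski space need not converge;
the part of it outside `K` does not depend on `s`.) -/
def IsCriticalPoint (k : ℕ∞) (B : TwoForm n N) (V : N → ℝ) (φ : Mink → N) : Prop :=
  ∀ Φ : ℝ × Mink → N, ContMDiff 𝓘(ℝ, ℝ × Mink) (𝓡 n) k Φ → (∀ p, Φ (0, p) = φ p) →
    ∀ K : Set Mink, IsCompact K → (∀ s, ∀ p, p ∉ K → Φ (s, p) = φ p) →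
      HasDerivAt (fun s : ℝ => action g B V K (fun p => Φ (s, p))) 0 0

end Target

end StringAction

end

/-!
The proof computes the first variation of the action and applies the fundamental lemma of the
calculus of variations.

Let `Φ : ℝ × Mink → N` be a variation of `φ`, with variation field `η = ∂_s Φ` at `s = 0`. The
pull-backs of the metric and of the two-form by `Φ`, evaluated on the constant fields `∂_s`, `∂_t`,
`∂_x`, are globally defined `C^1` functions, and so are the Lagrangian density `L` and the current
`X = (⟨φ_t, η⟩ + B(η, φ_x), -⟨φ_x, η⟩ + B(φ_t, η))`. A computation in the chart around `φ p`, where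
the Levi-Civita connection and `dB` are defined, gives the pointwise identity
`∂_s L = div X - ⟨τ(φ) - Z(φ_t ∧ φ_x) - ∇V(φ), η⟩` at every `p` (`fderiv_lagrangian`, from the
coordinate computation `fderiv_lagrangian_eq`). As `X` is a global function with compact support,
its divergence integrates to zero without a partition of unity, whence the first variation formula
`hasDerivAt_action`. It shows at once that solutions of the Euler-Lagrange equation are critical.

Conversely, let `φ` be critical. If `Φ` is a variation and `χ` a smooth function on Minkowski space,
then `(s, p) ↦ Φ (χ p * s, p)` is a variation with variation field `χ η` (`dirDeriv_reparam`). So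
the function `⟨τ(φ) - Z(φ_t ∧ φ_x) - ∇V(φ), η⟩` integrates to zero against every `χ`. It is continuous,
since the identity above expresses it by derivatives of global `C^1` functions; no comparison of
different charts is needed. Hence it vanishes identically. Finally `exists_variation` provides
variations whose field at a given point is a nonzero multiple of any prescribed vector, and the
metric is positive definite.
-/

noncomputable section

namespace StringAction

open Set Filter Topology MeasureTheory

/-! ### Directional derivatives in coordinates -/

section Charts

variable {n : ℕ} {N : Type*} [TopologicalSpace N] [ChartedSpace (EuclideanSpace ℝ (Fin n)) N]

/-- The derivative of a map `Φ` from a normed space to `N` at `P` in the direction `v`. On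
Minkowski space this is `pushforward`; families of maps are treated as maps on `ℝ × Mink`. -/
def dirDeriv {F : Type*} [NormedAddCommGroup F] [NormedSpace ℝ F] (Φ : F → N) (P v : F) :
    TangentSpace (𝓡 n) (Φ P) :=
  mfderiv 𝓘(ℝ, F) (𝓡 n) Φ P ((NormedSpace.fromTangentSpace P).symm v)

variable {F : Type*} [NormedAddCommGroup F] [NormedSpace ℝ F]

/-- Every tangent space of `N` is the model space, by definition. This allows the metrics at two
propositionally equal points to be compared on the same vectors. -/
theorem inner_congr_point [IsManifold (𝓡 n) ∞ N]
    (g : Bundle.ContMDiffRiemannianMetric (𝓡 n) ∞ (EuclideanSpace ℝ (Fin n))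
      (fun y : N => TangentSpace (𝓡 n) y)) {a b : N} (h : a = b) (v w : EuclideanSpace ℝ (Fin n)) :
    g.inner a v w = g.inner b v w := by
  subst h; rfl

theorem twoForm_congr_point (B : TwoForm n N) {a b : N} (h : a = b)
    (v : Fin 2 → EuclideanSpace ℝ (Fin n)) :
    (B a : EuclideanSpace ℝ (Fin n) [⋀^Fin 2]→L[ℝ] ℝ) v = B b v := by
  subst h; rfl

theorem eventually_mem_chart {T : Type*} [TopologicalSpace T] {Φ : T → N} {P : T}
    (hΦ : ContinuousAt Φ P) {y : N}
    (hy : Φ P ∈ (extChartAt (𝓡 n) y).source) :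
    ∀ᶠ Q in 𝓝 P, Φ Q ∈ (extChartAt (𝓡 n) y).source :=
  hΦ.eventually ((isOpen_extChartAt_source y).mem_nhds hy)

theorem TwoForm.IsOfClass.contDiffAt_coord {B : TwoForm n N} (hB : B.IsOfClass 1) {y : N}
    {z : EuclideanSpace ℝ (Fin n)}
    (hz : z ∈ (extChartAt (𝓡 n) y).target) : ContDiffAt ℝ 1 (B.coord y) z :=
  (hB y).contDiffAt ((isOpen_extChartAt_target y).mem_nhds hz)

theorem fderiv_comp_eq_mvfderiv {V : N → ℝ} (hV : ContMDiff (𝓡 n) 𝓘(ℝ, ℝ) 1 V) {Φ : F → N}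
    (hΦ : ContMDiff 𝓘(ℝ, F) (𝓡 n) 2 Φ) (P v : F) :
    fderiv ℝ (fun Q => V (Φ Q)) P v = mvfderiv (𝓡 n) V (Φ P) (dirDeriv Φ P v) := by
  have h := mfderiv_comp P (hV.mdifferentiableAt (x := Φ P) (by norm_num))
    (hΦ.mdifferentiableAt (x := P) (by norm_num))
  have h3 : mfderiv 𝓘(ℝ, F) 𝓘(ℝ, ℝ) (V ∘ Φ) P = fderiv ℝ (V ∘ Φ) P := mfderiv_eq_fderiv
  rw [h3] at h
  change fderiv ℝ (V ∘ Φ) P v = _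
  rw [h]
  rfl

theorem pushforward_eq_dirDeriv {Φ : ℝ × Mink → N} {s : ℝ} {p : Mink}
    (hΦ : MDifferentiableAt 𝓘(ℝ, ℝ × Mink) (𝓡 n) Φ (s, p)) (e : Mink) :
    pushforward (n := n) (fun q => Φ (s, q)) p e = dirDeriv Φ (s, p) (0, e) := by
  have hι : HasFDerivAt (fun q : Mink => (s, q)) (ContinuousLinearMap.inr ℝ ℝ Mink) p :=
    hasFDerivAt_prodMk_right s p
  have h := mfderiv_comp (I := 𝓘(ℝ, Mink)) (I' := 𝓘(ℝ, ℝ × Mink)) p hΦ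
    hι.hasMFDerivAt.mdifferentiableAt
  rw [hι.hasMFDerivAt.mfderiv] at h
  change mfderiv 𝓘(ℝ, Mink) (𝓡 n) (Φ ∘ fun q => (s, q)) p e = _
  rw [h]
  rfl

theorem fderiv_slice {X : Type*} [NormedAddCommGroup X] [NormedSpace ℝ X] {f : ℝ × Mink → X}
    {s : ℝ} {p : Mink} (hf : DifferentiableAt ℝ f (s, p)) (e : Mink) :
    fderiv ℝ (fun q => f (s, q)) p e = fderiv ℝ f (s, p) (0, e) := by
  have h := hf.hasFDerivAt.comp p (hasFDerivAt_prodMk_right (𝕜 := ℝ) s p)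
  have h' : fderiv ℝ (fun q => f (s, q)) p = _ := h.fderiv
  rw [h']; rfl

variable [IsManifold (𝓡 n) ∞ N]

/-- The tangent space at `y` is identified with the model space by means of the chart around `y`, so
this chart has identity derivative at `y`. -/
theorem chartDeriv_eq_id (y : N) :
    chartDeriv y = ContinuousLinearMap.id ℝ (EuclideanSpace ℝ (Fin n)) := by
  have : IsManifold (𝓡 n) 1 N := IsManifold.of_le (n := ∞) (by simp)
  have h := mfderiv_extChartAt_self (I := 𝓡 n) (x := y)
  ext1 v
  change mfderiv (𝓡 n) 𝓘(ℝ, EuclideanSpace ℝ (Fin n)) (extChartAt (𝓡 n) y) y v = v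
  rw [h]; rfl

/-- A directional derivative of `Φ` is the combination of the coordinate frame whose coefficients
are the derivatives of the coordinate expression of `Φ`. -/
theorem chartFrame_fderiv {Φ : F → N} {P : F} (hΦ : MDifferentiableAt 𝓘(ℝ, F) (𝓡 n) Φ P) {y : N}
    (hy : Φ P ∈ (extChartAt (𝓡 n) y).source) (v : F) :
    (dirDeriv Φ P v : EuclideanSpace ℝ (Fin n)) =
      chartFrame y (extChartAt (𝓡 n) y (Φ P))
        (fderiv ℝ (fun Q => extChartAt (𝓡 n) y (Φ Q)) P v) := by
  have : IsManifold (𝓡 n) 1 N := IsManifold.of_le (n := ∞) (by simp)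
  have hsrc : Φ P ∈ (chartAt (EuclideanSpace ℝ (Fin n)) y).source := by simpa using hy
  have hU : MDifferentiableAt 𝓘(ℝ, F) 𝓘(ℝ, EuclideanSpace ℝ (Fin n))
      (fun Q => extChartAt (𝓡 n) y (Φ Q)) P :=
    (mdifferentiableAt_extChartAt hsrc).comp P hΦ
  have htgt : extChartAt (𝓡 n) y (Φ P) ∈ (extChartAt (𝓡 n) y).target :=
    (extChartAt (𝓡 n) y).map_source hy
  have hS : MDifferentiableAt 𝓘(ℝ, EuclideanSpace ℝ (Fin n)) (𝓡 n) (extChartAt (𝓡 n) y).symm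
      (extChartAt (𝓡 n) y (Φ P)) := by
    have := mdifferentiableWithinAt_extChartAt_symm (I := 𝓡 n) htgt
    rw [ModelWithCorners.range_eq_univ, mdifferentiableWithinAt_univ] at this
    exact this
  have hEq : Φ =ᶠ[𝓝 P] (extChartAt (𝓡 n) y).symm ∘ (fun Q => extChartAt (𝓡 n) y (Φ Q)) := by
    have : ∀ᶠ Q in 𝓝 P, Φ Q ∈ (extChartAt (𝓡 n) y).source :=
      hΦ.continuousAt.eventually ((isOpen_extChartAt_source y).mem_nhds hy)
    filter_upwards [this] with Q hQ
    exact ((extChartAt (𝓡 n) y).left_inv hQ).symm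
  have h1 := hEq.mfderiv_eq (I := 𝓘(ℝ, F)) (I' := 𝓡 n)
  have h2 := mfderiv_comp P hS hU
  have h3 : mfderiv 𝓘(ℝ, F) 𝓘(ℝ, EuclideanSpace ℝ (Fin n))
      (fun Q => extChartAt (𝓡 n) y (Φ Q)) P = fderiv ℝ (fun Q => extChartAt (𝓡 n) y (Φ Q)) P :=
    mfderiv_eq_fderiv
  change (mfderiv 𝓘(ℝ, F) (𝓡 n) Φ P : F →L[ℝ] EuclideanSpace ℝ (Fin n)) v = _
  rw [h1]
  change (mfderiv 𝓘(ℝ, F) (𝓡 n) ((extChartAt (𝓡 n) y).symm ∘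
    (fun Q => extChartAt (𝓡 n) y (Φ Q))) P : F →L[ℝ] EuclideanSpace ℝ (Fin n)) v = _
  rw [h2, h3]
  rfl

theorem inner_dirDeriv
    (g : Bundle.ContMDiffRiemannianMetric (𝓡 n) ∞ (EuclideanSpace ℝ (Fin n))
      (fun y : N => TangentSpace (𝓡 n) y))
    {Φ : F → N} {P : F} (hΦ : MDifferentiableAt 𝓘(ℝ, F) (𝓡 n) Φ P) {y : N}
    (hy : Φ P ∈ (extChartAt (𝓡 n) y).source) (v w : F) :
    g.inner (Φ P) (dirDeriv Φ P v) (dirDeriv Φ P w) =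
      metricCoord g y (extChartAt (𝓡 n) y (Φ P))
        (fderiv ℝ (fun Q => extChartAt (𝓡 n) y (Φ Q)) P v)
        (fderiv ℝ (fun Q => extChartAt (𝓡 n) y (Φ Q)) P w) := by
  have hp := (extChartAt (𝓡 n) y).left_inv hy
  have hv := chartFrame_fderiv hΦ hy v
  have hw := chartFrame_fderiv hΦ hy w
  refine (inner_congr_point g hp.symm _ _).trans ?_
  rw [hv, hw]
  rfl

theorem twoForm_dirDeriv (B : TwoForm n N)
    {Φ : F → N} {P : F} (hΦ : MDifferentiableAt 𝓘(ℝ, F) (𝓡 n) Φ P) {y : N}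
    (hy : Φ P ∈ (extChartAt (𝓡 n) y).source) (v w : F) :
    B (Φ P) ![dirDeriv Φ P v, dirDeriv Φ P w] =
      B.coord y (extChartAt (𝓡 n) y (Φ P))
        ![fderiv ℝ (fun Q => extChartAt (𝓡 n) y (Φ Q)) P v,
          fderiv ℝ (fun Q => extChartAt (𝓡 n) y (Φ Q)) P w] := by
  have hp := (extChartAt (𝓡 n) y).left_inv hy
  have hv := chartFrame_fderiv hΦ hy v
  have hw := chartFrame_fderiv hΦ hy w
  refine (twoForm_congr_point B hp.symm _).trans ?_
  change _ = B _ (chartFrame y _ ∘ _)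
  congr 1
  funext i
  fin_cases i
  · exact hv
  · exact hw

theorem metricCoord_symm
    (g : Bundle.ContMDiffRiemannianMetric (𝓡 n) ∞ (EuclideanSpace ℝ (Fin n))
      (fun y : N => TangentSpace (𝓡 n) y)) (y : N) (z a b : EuclideanSpace ℝ (Fin n)) :
    metricCoord g y z a b = metricCoord g y z b a :=
  g.symm _ _ _

/-- The coordinate frame is a `C^1` section of the tangent bundle: over the chart domain it is the
inverse of a local trivialisation. -/
theorem contMDiffOn_chartFrame (y : N) (a : EuclideanSpace ℝ (Fin n)) :
    ContMDiffOn 𝓘(ℝ, EuclideanSpace ℝ (Fin n)) ((𝓡 n).prod 𝓘(ℝ, EuclideanSpace ℝ (Fin n))) 1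
      (fun z => Bundle.TotalSpace.mk' (EuclideanSpace ℝ (Fin n)) (E := TangentSpace (𝓡 n) (M := N))
        ((extChartAt (𝓡 n) y).symm z) (chartFrame y z a)) (extChartAt (𝓡 n) y).target := by
  have : IsManifold (𝓡 n) 1 N := IsManifold.of_le (n := ∞) (by simp)
  have hE := (trivializationAt (EuclideanSpace ℝ (Fin n)) (TangentSpace (𝓡 n)) y).contMDiffOn_symmL
    (𝕜 := ℝ) (IB := 𝓡 n) (n := 1)
  have hmaps : MapsTo (extChartAt (𝓡 n) y).symm (extChartAt (𝓡 n) y).target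
      (trivializationAt (EuclideanSpace ℝ (Fin n)) (TangentSpace (𝓡 n)) y).baseSet := by
    intro z hz
    simpa using (extChartAt (𝓡 n) y).map_target hz
  have hE' := hE.comp (contMDiffOn_extChartAt_symm (n := 1) y) hmaps
  have hc : ContMDiffOn 𝓘(ℝ, EuclideanSpace ℝ (Fin n))
      ((𝓡 n).prod 𝓘(ℝ, EuclideanSpace ℝ (Fin n))) 1
      (fun z => Bundle.TotalSpace.mk' (EuclideanSpace ℝ (Fin n))
        (E := Bundle.Trivial N (EuclideanSpace ℝ (Fin n)))
        ((extChartAt (𝓡 n) y).symm z) a) (extChartAt (𝓡 n) y).target := by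
    intro z hz
    rw [Bundle.contMDiffWithinAt_totalSpace]
    exact ⟨contMDiffOn_extChartAt_symm y z hz, contMDiffWithinAt_const⟩
  have h := ContMDiffOn.clm_bundle_apply hE' hc
  refine h.congr fun z hz => ?_
  have hz' : (extChartAt (𝓡 n) y).symm z ∈ (chartAt (EuclideanSpace ℝ (Fin n)) y).source := by
    simpa using (extChartAt (𝓡 n) y).map_target hz
  have h2 := TangentBundle.symmL_trivializationAt (𝕜 := ℝ) (I := 𝓡 n) hz'
  rw [(extChartAt (𝓡 n) y).right_inv hz, ModelWithCorners.range_eq_univ, mfderivWithin_univ] at h2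
  congr 1
  exact (congrArg (fun L => L a) h2).symm

theorem contDiffOn_metricCoord
    (g : Bundle.ContMDiffRiemannianMetric (𝓡 n) ∞ (EuclideanSpace ℝ (Fin n))
      (fun y : N => TangentSpace (𝓡 n) y)) (y : N) :
    ContDiffOn ℝ 1 (metricCoord g y) (extChartAt (𝓡 n) y).target := by
  have : IsManifold (𝓡 n) 1 N := IsManifold.of_le (n := ∞) (by simp)
  rw [contDiffOn_clm_apply]
  intro a
  rw [contDiffOn_clm_apply]
  intro b
  have hg : ContMDiffOn 𝓘(ℝ, EuclideanSpace ℝ (Fin n))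
      ((𝓡 n).prod 𝓘(ℝ, EuclideanSpace ℝ (Fin n) →L[ℝ] EuclideanSpace ℝ (Fin n) →L[ℝ] ℝ)) 1
      (fun z => Bundle.TotalSpace.mk'
        (EuclideanSpace ℝ (Fin n) →L[ℝ] EuclideanSpace ℝ (Fin n) →L[ℝ] ℝ)
        (E := fun x : N => TangentSpace (𝓡 n) x →L[ℝ] TangentSpace (𝓡 n) x →L[ℝ] ℝ)
        ((extChartAt (𝓡 n) y).symm z) (g.inner ((extChartAt (𝓡 n) y).symm z)))
      (extChartAt (𝓡 n) y).target :=
    (g.contMDiff.of_le (by simp)).comp_contMDiffOn (contMDiffOn_extChartAt_symm y)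
  have h := ContMDiffOn.clm_bundle_apply₂ (F₁ := EuclideanSpace ℝ (Fin n))
    (F₂ := EuclideanSpace ℝ (Fin n)) (F₃ := ℝ) (E₃ := Bundle.Trivial N ℝ) hg
    (contMDiffOn_chartFrame y a) (contMDiffOn_chartFrame y b)
  intro z hz
  have h' := h z hz
  rw [Bundle.contMDiffWithinAt_totalSpace] at h'
  exact h'.2.contDiffWithinAt

end Charts

/-! ### The first variation in coordinates -/

section LocalComputation

variable {W E : Type*} [NormedAddCommGroup W] [NormedSpace ℝ W] [NormedAddCommGroup E]
  [NormedSpace ℝ E]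

/-- An alternating two-form, regarded as a bilinear form. -/
def altToBilin : (E [⋀^Fin 2]→L[ℝ] ℝ) →L[ℝ] E →L[ℝ] E →L[ℝ] ℝ :=
  (ContinuousLinearMap.compL ℝ E (E [×1]→L[ℝ] ℝ) (E →L[ℝ] ℝ)
      (continuousMultilinearCurryFin1 ℝ E ℝ).toContinuousLinearEquiv.toContinuousLinearMap).comp
    ((continuousMultilinearCurryLeftEquiv ℝ
        (fun _ : Fin 2 => E) ℝ).toContinuousLinearEquiv.toContinuousLinearMap.comp
      (ContinuousAlternatingMap.toContinuousMultilinearMapCLM ℝ))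

theorem altToBilin_apply (β : E [⋀^Fin 2]→L[ℝ] ℝ) (v w : E) : altToBilin β v w = β ![v, w] := by
  have h : (Fin.cons v (Fin.snoc (0 : Fin 0 → E) w) : Fin 2 → E) = ![v, w] := by
    funext i; fin_cases i <;> rfl
  change β (Fin.cons v (Fin.snoc (0 : Fin 0 → E) w)) = _
  rw [h]

theorem altToBilin_swap (β : E [⋀^Fin 2]→L[ℝ] ℝ) (v w : E) :
    altToBilin β v w = -altToBilin β w v := by
  rw [altToBilin_apply, altToBilin_apply]
  have h : β (![v, w] ∘ ⇑(Equiv.swap (0 : Fin 2) 1)) = -β ![v, w] :=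
    β.toAlternatingMap.map_swap ![v, w] (by decide)
  have h' : (![v, w] ∘ ⇑(Equiv.swap (0 : Fin 2) 1)) = ![w, v] := by
    funext i; fin_cases i <;> simp
  rw [h'] at h
  rw [h, neg_neg]

theorem hasFDerivAt_altToBilin_comp {b : E → E [⋀^Fin 2]→L[ℝ] ℝ} {z : E}
    {b' : E →L[ℝ] E [⋀^Fin 2]→L[ℝ] ℝ} (hb : HasFDerivAt b b' z) :
    HasFDerivAt (fun z => altToBilin (b z)) (altToBilin.comp b') z := by
  have h : HasFDerivAt (F := E →L[ℝ] E →L[ℝ] ℝ) altToBilin altToBilin (b z) :=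
    ContinuousLinearMap.hasFDerivAt (F := E →L[ℝ] E →L[ℝ] ℝ) (altToBilin (E := E))
  exact HasFDerivAt.comp (G := E →L[ℝ] E →L[ℝ] ℝ) z h hb

theorem contDiffAt_altToBilin_comp {b : E → E [⋀^Fin 2]→L[ℝ] ℝ} {z : E} {r : WithTop ℕ∞}
    (hb : ContDiffAt ℝ r b z) : ContDiffAt ℝ r (fun z => altToBilin (b z)) z := by
  have h : ContDiff ℝ r (F := E →L[ℝ] E →L[ℝ] ℝ) altToBilin :=
    ContinuousLinearMap.contDiff (𝕜 := ℝ) (E := E [⋀^Fin 2]→L[ℝ] ℝ)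
      (F := E →L[ℝ] E →L[ℝ] ℝ) (n := r) (altToBilin (E := E))
  exact ContDiffAt.comp (G := E →L[ℝ] E →L[ℝ] ℝ) z h.contDiffAt hb

/-- The pull-back of a field `K` of bilinear forms by a map `U`, evaluated at constant vectors. -/
def bilinPullback (K : E → E →L[ℝ] E →L[ℝ] ℝ) (U : W → E) (v w : W) (Q : W) : ℝ :=
  K (U Q) (fderiv ℝ U Q v) (fderiv ℝ U Q w)

theorem contDiffAt_fderiv_apply_const {U : W → E} {P : W} (hU : ContDiffAt ℝ 2 U P) (v : W) :
    ContDiffAt ℝ 1 (fun Q => fderiv ℝ U Q v) P :=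
  (hU.fderiv_right (m := 1) (by norm_num)).clm_apply contDiffAt_const

theorem contDiffAt_bilinPullback {K : E → E →L[ℝ] E →L[ℝ] ℝ} {U : W → E} {P : W}
    (hU : ContDiffAt ℝ 2 U P) (hK : ContDiffAt ℝ 1 K (U P)) (v w : W) :
    ContDiffAt ℝ 1 (bilinPullback K U v w) P :=
  ((hK.comp P (hU.of_le (by norm_num))).clm_apply (contDiffAt_fderiv_apply_const hU v)).clm_apply
    (contDiffAt_fderiv_apply_const hU w)

theorem fderiv_bilinPullback {K : E → E →L[ℝ] E →L[ℝ] ℝ} {U : W → E} {P : W}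
    (hU : ContDiffAt ℝ 2 U P) (hK : DifferentiableAt ℝ K (U P)) (v w e : W) :
    fderiv ℝ (bilinPullback K U v w) P e =
      fderiv ℝ K (U P) (fderiv ℝ U P e) (fderiv ℝ U P v) (fderiv ℝ U P w)
        + K (U P) (fderiv ℝ (fderiv ℝ U) P e v) (fderiv ℝ U P w)
        + K (U P) (fderiv ℝ U P v) (fderiv ℝ (fderiv ℝ U) P e w) := by
  have hU1 : HasFDerivAt U (fderiv ℝ U P) P := (hU.differentiableAt (by norm_num)).hasFDerivAt
  have hU2 : HasFDerivAt (fderiv ℝ U) (fderiv ℝ (fderiv ℝ U) P) P :=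
    ((hU.fderiv_right (m := 1) (by norm_num)).differentiableAt (by norm_num)).hasFDerivAt
  have hKU : HasFDerivAt (fun Q => K (U Q)) ((fderiv ℝ K (U P)).comp (fderiv ℝ U P)) P :=
    HasFDerivAt.comp (G := E →L[ℝ] E →L[ℝ] ℝ) P hK.hasFDerivAt hU1
  have h := (hKU.clm_apply (hU2.clm_apply (hasFDerivAt_const v P))).clm_apply
    (hU2.clm_apply (hasFDerivAt_const w P))
  have h' : fderiv ℝ (bilinPullback K U v w) P = _ := h.fderiv
  rw [h']
  simp
  ring

/-- The first variation in coordinates, without the potential: the derivative of the Lagrangian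
density in the direction `σ` is the divergence of a current plus the Euler-Lagrange expression
evaluated on the variation field `∂_σ U`. The terms with a derivative `∂_σ ∂_t U` or `∂_σ ∂_x U`
all belong to the divergence; what remains of the derivatives of `G` are Christoffel symbols of the
first kind, and what remains of those of `b` is the exterior derivative. -/
theorem fderiv_lagrangian_eq {G : E → E →L[ℝ] E →L[ℝ] ℝ} {b : E → E [⋀^Fin 2]→L[ℝ] ℝ}
    {U : W → E} {P : W} (hU : ContDiffAt ℝ 2 U P) (hG : DifferentiableAt ℝ G (U P))
    (hsymm : ∀ z v w, G z v w = G z w v) (hb : DifferentiableAt ℝ b (U P))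
    (t x σ : W) :
    (1 / 2) * (fderiv ℝ (bilinPullback G U t t) P σ - fderiv ℝ (bilinPullback G U x x) P σ)
        + fderiv ℝ (bilinPullback (fun z => altToBilin (b z)) U t x) P σ =
      fderiv ℝ (bilinPullback G U t σ) P t
        + fderiv ℝ (bilinPullback (fun z => altToBilin (b z)) U σ x) P t
        - fderiv ℝ (bilinPullback G U x σ) P x
        + fderiv ℝ (bilinPullback (fun z => altToBilin (b z)) U t σ) P x
        + (-(G (U P) (fderiv ℝ (fderiv ℝ U) P t t) (fderiv ℝ U P σ)
              + (1 / 2) * (fderiv ℝ G (U P) (fderiv ℝ U P t) (fderiv ℝ U P t) (fderiv ℝ U P σ)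
                + fderiv ℝ G (U P) (fderiv ℝ U P t) (fderiv ℝ U P t) (fderiv ℝ U P σ)
                - fderiv ℝ G (U P) (fderiv ℝ U P σ) (fderiv ℝ U P t) (fderiv ℝ U P t)))
            + (G (U P) (fderiv ℝ (fderiv ℝ U) P x x) (fderiv ℝ U P σ)
              + (1 / 2) * (fderiv ℝ G (U P) (fderiv ℝ U P x) (fderiv ℝ U P x) (fderiv ℝ U P σ)
                + fderiv ℝ G (U P) (fderiv ℝ U P x) (fderiv ℝ U P x) (fderiv ℝ U P σ)
                - fderiv ℝ G (U P) (fderiv ℝ U P σ) (fderiv ℝ U P x) (fderiv ℝ U P x)))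
            + extDeriv b (U P) ![fderiv ℝ U P σ, fderiv ℝ U P t, fderiv ℝ U P x]) := by
  have hbil : DifferentiableAt ℝ (fun z => altToBilin (b z)) (U P) :=
    (hasFDerivAt_altToBilin_comp hb.hasFDerivAt).differentiableAt
  have hbil' : ∀ e v w, fderiv ℝ (fun z => altToBilin (b z)) (U P) e v w
      = fderiv ℝ b (U P) e ![v, w] := by
    intro e v w
    have h : fderiv ℝ (fun z => altToBilin (b z)) (U P) = altToBilin.comp (fderiv ℝ b (U P)) :=
      (hasFDerivAt_altToBilin_comp hb.hasFDerivAt).fderiv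
    rw [h]
    exact altToBilin_apply _ _ _
  have hD : ∀ v w, fderiv ℝ (fderiv ℝ U) P v w = fderiv ℝ (fderiv ℝ U) P w v := fun v w =>
    (hU.isSymmSndFDerivAt (by simp)) v w
  have hd : extDeriv b (U P) ![fderiv ℝ U P σ, fderiv ℝ U P t, fderiv ℝ U P x] =
      fderiv ℝ b (U P) (fderiv ℝ U P σ) ![fderiv ℝ U P t, fderiv ℝ U P x]
      - fderiv ℝ b (U P) (fderiv ℝ U P t) ![fderiv ℝ U P σ, fderiv ℝ U P x]
      + fderiv ℝ b (U P) (fderiv ℝ U P x) ![fderiv ℝ U P σ, fderiv ℝ U P t] := by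
    rw [extDeriv, ContinuousAlternatingMap.alternatizeUncurryFin_apply, Fin.sum_univ_three]
    have h0 : Fin.removeNth 0 ![fderiv ℝ U P σ, fderiv ℝ U P t, fderiv ℝ U P x] =
        ![fderiv ℝ U P t, fderiv ℝ U P x] := by
      funext i; fin_cases i <;> rfl
    have h1 : Fin.removeNth 1 ![fderiv ℝ U P σ, fderiv ℝ U P t, fderiv ℝ U P x] =
        ![fderiv ℝ U P σ, fderiv ℝ U P x] := by
      funext i; fin_cases i <;> rfl
    have h2 : Fin.removeNth 2 ![fderiv ℝ U P σ, fderiv ℝ U P t, fderiv ℝ U P x] =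
        ![fderiv ℝ U P σ, fderiv ℝ U P t] := by
      funext i; fin_cases i <;> rfl
    rw [h0, h1, h2]
    simp
    ring
  have hsw : fderiv ℝ b (U P) (fderiv ℝ U P x) ![fderiv ℝ U P t, fderiv ℝ U P σ] =
      -fderiv ℝ b (U P) (fderiv ℝ U P x) ![fderiv ℝ U P σ, fderiv ℝ U P t] := by
    rw [← altToBilin_apply, ← altToBilin_apply, altToBilin_swap]
  -- with second derivatives and both forms brought to a common order of arguments, all terms match
  simp only [fderiv_bilinPullback hU hG, fderiv_bilinPullback hU hbil, hbil', hd, hsw]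
  rw [hD σ t, hD σ x, hD x t, hsymm _ (fderiv ℝ U P t) (fderiv ℝ (fderiv ℝ U) P t σ),
    hsymm _ (fderiv ℝ U P x) (fderiv ℝ (fderiv ℝ U) P x σ),
    altToBilin_swap _ (fderiv ℝ U P σ) (fderiv ℝ (fderiv ℝ U) P t x)]
  ring

end LocalComputation

/-! ### Pull-backs of the metric and of the two-form -/

section Pullbacks

variable {n : ℕ} {N : Type*} [TopologicalSpace N] [ChartedSpace (EuclideanSpace ℝ (Fin n)) N]
  [IsManifold (𝓡 n) ∞ N]
  (g : Bundle.ContMDiffRiemannianMetric (𝓡 n) ∞ (EuclideanSpace ℝ (Fin n))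
      (fun y : N => TangentSpace (𝓡 n) y))
  {F : Type*} [NormedAddCommGroup F] [NormedSpace ℝ F]

/-- The pull-back `Φ^*g`, evaluated at the constant vector fields `v`, `w`. -/
def metricPullback (Φ : F → N) (v w : F) (Q : F) : ℝ :=
  g.inner (Φ Q) (dirDeriv Φ Q v) (dirDeriv Φ Q w)

/-- The pull-back `Φ^*B`, evaluated at the constant vector fields `v`, `w`. -/
def formPullback (B : TwoForm n N) (Φ : F → N) (v w : F) (Q : F) : ℝ :=
  B (Φ Q) ![dirDeriv Φ Q v, dirDeriv Φ Q w]

theorem contDiffAt_chart_comp {Φ : F → N} {r : ℕ∞} {P : F}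
    (hΦ : ContMDiffAt 𝓘(ℝ, F) (𝓡 n) r Φ P) {y : N}
    (hy : Φ P ∈ (extChartAt (𝓡 n) y).source) :
    ContDiffAt ℝ r (fun Q => extChartAt (𝓡 n) y (Φ Q)) P := by
  have : IsManifold (𝓡 n) r N := IsManifold.of_le (n := ∞) (by exact_mod_cast le_top)
  have h := contMDiffAt_extChartAt' (I := 𝓡 n) (n := r) (x := y) (x' := Φ P) (by simpa using hy)
  exact (h.comp P hΦ).contDiffAt

theorem metricPullback_eventuallyEq {Φ : F → N} (hΦ : ContMDiff 𝓘(ℝ, F) (𝓡 n) 2 Φ) {P : F} {y : N}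
    (hy : Φ P ∈ (extChartAt (𝓡 n) y).source) (v w : F) :
    metricPullback g Φ v w =ᶠ[𝓝 P]
      bilinPullback (metricCoord g y) (fun Q => extChartAt (𝓡 n) y (Φ Q)) v w := by
  filter_upwards [eventually_mem_chart hΦ.continuous.continuousAt hy] with Q hQ
  exact inner_dirDeriv g (hΦ.mdifferentiableAt (by norm_num)) hQ v w

theorem formPullback_eventuallyEq (B : TwoForm n N) {Φ : F → N}
    (hΦ : ContMDiff 𝓘(ℝ, F) (𝓡 n) 2 Φ) {P : F} {y : N}
    (hy : Φ P ∈ (extChartAt (𝓡 n) y).source) (v w : F) :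
    formPullback B Φ v w =ᶠ[𝓝 P]
      bilinPullback (fun z => altToBilin (B.coord y z))
        (fun Q => extChartAt (𝓡 n) y (Φ Q)) v w := by
  filter_upwards [eventually_mem_chart hΦ.continuous.continuousAt hy] with Q hQ
  rw [bilinPullback, altToBilin_apply]
  exact twoForm_dirDeriv B (hΦ.mdifferentiableAt (by norm_num)) hQ v w

theorem contDiffAt_metricCoord {y : N} {z : EuclideanSpace ℝ (Fin n)}
    (hz : z ∈ (extChartAt (𝓡 n) y).target) : ContDiffAt ℝ 1 (metricCoord g y) z :=
  (contDiffOn_metricCoord g y).contDiffAt ((isOpen_extChartAt_target y).mem_nhds hz)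

theorem contDiff_metricPullback {Φ : F → N} (hΦ : ContMDiff 𝓘(ℝ, F) (𝓡 n) 2 Φ) (v w : F) :
    ContDiff ℝ 1 (metricPullback g Φ v w) := by
  rw [contDiff_iff_contDiffAt]
  intro P
  have hy := mem_extChartAt_source (I := 𝓡 n) (Φ P)
  refine ContDiffAt.congr_of_eventuallyEq ?_ (metricPullback_eventuallyEq g hΦ hy v w)
  exact contDiffAt_bilinPullback (contDiffAt_chart_comp (r := 2) (hΦ P) hy)
    (contDiffAt_metricCoord g ((extChartAt (𝓡 n) _).map_source hy)) v w

theorem contDiff_formPullback {B : TwoForm n N} (hB : B.IsOfClass 1) {Φ : F → N}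
    (hΦ : ContMDiff 𝓘(ℝ, F) (𝓡 n) 2 Φ) (v w : F) :
    ContDiff ℝ 1 (formPullback B Φ v w) := by
  rw [contDiff_iff_contDiffAt]
  intro P
  have hy := mem_extChartAt_source (I := 𝓡 n) (Φ P)
  refine ContDiffAt.congr_of_eventuallyEq ?_ (formPullback_eventuallyEq B hΦ hy v w)
  exact contDiffAt_bilinPullback (contDiffAt_chart_comp (r := 2) (hΦ P) hy)
    (contDiffAt_altToBilin_comp (hB.contDiffAt_coord ((extChartAt (𝓡 n) _).map_source hy))) v w

theorem mvfderiv_chart_dirDeriv {Φ : F → N} {P : F} (hΦ : MDifferentiableAt 𝓘(ℝ, F) (𝓡 n) Φ P)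
    {y : N} (hy : Φ P ∈ (extChartAt (𝓡 n) y).source) (v : F) :
    mvfderiv (𝓡 n) (extChartAt (𝓡 n) y) (Φ P) (dirDeriv Φ P v) =
      fderiv ℝ (fun Q => extChartAt (𝓡 n) y (Φ Q)) P v := by
  have : IsManifold (𝓡 n) 1 N := IsManifold.of_le (n := ∞) (by simp)
  have h := mfderiv_comp P
    (mdifferentiableAt_extChartAt (I := 𝓡 n) (x := y) (y := Φ P) (by simpa using hy)) hΦ
  have h3 : mfderiv 𝓘(ℝ, F) 𝓘(ℝ, EuclideanSpace ℝ (Fin n)) (extChartAt (𝓡 n) y ∘ Φ) P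
      = fderiv ℝ (extChartAt (𝓡 n) y ∘ Φ) P := mfderiv_eq_fderiv
  rw [h3] at h
  change _ = fderiv ℝ (extChartAt (𝓡 n) y ∘ Φ) P v
  rw [h]
  rfl

/-- In the chart around `Φ P` itself, directional derivatives at `P` are ordinary ones. -/
theorem dirDeriv_eq_fderiv {Φ : F → N} {P : F} (hΦ : MDifferentiableAt 𝓘(ℝ, F) (𝓡 n) Φ P) (v : F) :
    (dirDeriv Φ P v : EuclideanSpace ℝ (Fin n)) =
      fderiv ℝ (fun Q => extChartAt (𝓡 n) (Φ P) (Φ Q)) P v := by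
  rw [← mvfderiv_chart_dirDeriv hΦ (mem_extChartAt_source (Φ P))]
  exact (congrArg (fun L : EuclideanSpace ℝ (Fin n) →L[ℝ] EuclideanSpace ℝ (Fin n) =>
    L (dirDeriv Φ P v)) (chartDeriv_eq_id (Φ P))).symm

theorem inner_eq_metricCoord_self (y : N) (v w : EuclideanSpace ℝ (Fin n)) :
    g.inner y v w = metricCoord g y (extChartAt (𝓡 n) y y) v w := by
  have : IsManifold (𝓡 n) 1 N := IsManifold.of_le (n := ∞) (by simp)
  have h := mfderivWithin_range_extChartAt_symm (I := 𝓡 n) (x := y)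
  rw [ModelWithCorners.range_eq_univ, mfderivWithin_univ] at h
  have h' : ∀ v : EuclideanSpace ℝ (Fin n), chartFrame y (extChartAt (𝓡 n) y y) v = v := by
    intro v
    change mfderiv 𝓘(ℝ, EuclideanSpace ℝ (Fin n)) (𝓡 n) (extChartAt (𝓡 n) y).symm
      (extChartAt (𝓡 n) y y) v = v
    rw [h]; rfl
  change _ = g.inner _ (chartFrame y (extChartAt (𝓡 n) y y) v)
    (chartFrame y (extChartAt (𝓡 n) y y) w)
  rw [h', h']
  exact inner_congr_point g ((extChartAt (𝓡 n) y).left_inv (mem_extChartAt_source y)).symm v w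

end Pullbacks

/-! ### The first variation of the Lagrangian density -/

section FirstVariation

variable {n : ℕ} {N : Type*} [TopologicalSpace N] [ChartedSpace (EuclideanSpace ℝ (Fin n)) N]
  [IsManifold (𝓡 n) ∞ N]
  (g : Bundle.ContMDiffRiemannianMetric (𝓡 n) ∞ (EuclideanSpace ℝ (Fin n))
      (fun y : N => TangentSpace (𝓡 n) y))

/-- The Levi-Civita acceleration of a slice of a family of maps, paired with a tangent vector, in
the chart around the base point. -/
theorem inner_pullbackCovDeriv {Φ : ℝ × Mink → N} (hΦ : ContMDiff 𝓘(ℝ, ℝ × Mink) (𝓡 n) 2 Φ)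
    (p e : Mink) (σ : ℝ × Mink) :
    let y := Φ (0, p)
    let U := fun Q => extChartAt (𝓡 n) y (Φ Q)
    g.inner (Φ (0, p)) (pullbackCovDeriv g (fun q => Φ (0, q))
      (fun q => pushforward (fun q => Φ (0, q)) q e) p e) (dirDeriv Φ (0, p) σ) =
    metricCoord g y (U (0, p)) (fderiv ℝ (fderiv ℝ U) (0, p) (0, e) (0, e))
        (fderiv ℝ U (0, p) σ)
      + (1 / 2) * (fderiv ℝ (metricCoord g y) (U (0, p)) (fderiv ℝ U (0, p) (0, e))
            (fderiv ℝ U (0, p) (0, e)) (fderiv ℝ U (0, p) σ)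
          + fderiv ℝ (metricCoord g y) (U (0, p)) (fderiv ℝ U (0, p) (0, e))
            (fderiv ℝ U (0, p) (0, e)) (fderiv ℝ U (0, p) σ)
          - fderiv ℝ (metricCoord g y) (U (0, p)) (fderiv ℝ U (0, p) σ)
            (fderiv ℝ U (0, p) (0, e)) (fderiv ℝ U (0, p) (0, e))) := by
  intro y U
  have hmd : ∀ Q, MDifferentiableAt 𝓘(ℝ, ℝ × Mink) (𝓡 n) Φ Q := fun Q =>
    hΦ.mdifferentiableAt (by norm_num)
  have hsrc : Φ (0, p) ∈ (extChartAt (𝓡 n) y).source :=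
    mem_extChartAt_source _
  have hU : ContDiffAt ℝ 2 U (0, p) := contDiffAt_chart_comp (r := 2) (hΦ _) hsrc
  have hη : ∀ v, (dirDeriv Φ (0, p) v : EuclideanSpace ℝ (Fin n)) = fderiv ℝ U (0, p) v :=
    dirDeriv_eq_fderiv (hmd _)
  have hpush : (pushforward (fun q => Φ (0, q)) p e : EuclideanSpace ℝ (Fin n))
      = fderiv ℝ U (0, p) (0, e) := (pushforward_eq_dirDeriv (hmd _) e).trans (hη _)
  have hacc : fderiv ℝ (fun q => mvfderiv (𝓡 n) (extChartAt (𝓡 n) (Φ (0, p))) (Φ (0, q))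
      (pushforward (fun q => Φ (0, q)) q e)) p e
      = fderiv ℝ (fderiv ℝ U) (0, p) (0, e) (0, e) := by
    have hev : (fun q => mvfderiv (𝓡 n) (extChartAt (𝓡 n) (Φ (0, p))) (Φ (0, q))
        (pushforward (fun q => Φ (0, q)) q e)) =ᶠ[𝓝 p] fun q => fderiv ℝ U (0, q) (0, e) := by
      have hc : ContinuousAt (fun q : Mink => Φ (0, q)) p :=
        (hΦ.continuous.comp (by fun_prop)).continuousAt
      filter_upwards [eventually_mem_chart hc hsrc] with q hq
      rw [pushforward_eq_dirDeriv (hmd _)]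
      exact mvfderiv_chart_dirDeriv (hmd _) hq _
    have hU' : ContDiffAt ℝ 1 (fderiv ℝ U) (0, p) := hU.fderiv_right (m := 1) (by norm_num)
    rw [hev.fderiv_eq, fderiv_slice (f := fun Q => fderiv ℝ U Q (0, e))
      ((contDiffAt_fderiv_apply_const hU _).differentiableAt (by norm_num)) e]
    have h := ((hU'.differentiableAt (by norm_num)).hasFDerivAt.clm_apply
      (hasFDerivAt_const ((0, e) : ℝ × Mink) ((0, p) : ℝ × Mink))).fderiv
    rw [h]
    simp
  unfold pullbackCovDeriv
  rw [hacc, map_add, add_apply]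
  congr 1
  · rw [chartDeriv_eq_id]
    refine Eq.trans ?_ (inner_eq_metricCoord_self g y _ _)
    rw [← hη]
    congr 1
    exact congrArg _ (congrArg (fun L : EuclideanSpace ℝ (Fin n) →L[ℝ] EuclideanSpace ℝ (Fin n) =>
      L _) ContinuousLinearMap.inverse_id)
  · refine (inner_sharp g _ _ _).trans ?_
    rw [chartDeriv_eq_id]
    change christoffelFirst g y (pushforward (fun q => Φ (0, q)) p e)
      (pushforward (fun q => Φ (0, q)) p e) (dirDeriv Φ (0, p) σ) = _
    rw [hpush, hη]
    simp [christoffelFirst, y, U]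

/-- The direction of the variation parameter in `ℝ × Mink`. -/
def dirS : ℝ × Mink := (1, 0)

/-- The direction `∂_t` in `ℝ × Mink`. -/
def dirT : ℝ × Mink := (0, dt)

/-- The direction `∂_x` in `ℝ × Mink`. -/
def dirX : ℝ × Mink := (0, dx)

/-- The Lagrangian density of a family of maps, as a function of the parameter and the point. -/
def lagrangian (B : TwoForm n N) (V : N → ℝ) (Φ : ℝ × Mink → N) (Q : ℝ × Mink) : ℝ :=
  (1 / 2) * (metricPullback g Φ dirT dirT Q - metricPullback g Φ dirX dirX Q)
    + formPullback B Φ dirT dirX Q + V (Φ Q)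

/-- The `∂_t` component `⟨φ_t, η⟩ + B(η, φ_x)` of the current of a family of maps with variation
field `η`. -/
def currentT (B : TwoForm n N) (Φ : ℝ × Mink → N) (Q : ℝ × Mink) : ℝ :=
  metricPullback g Φ dirT dirS Q + formPullback B Φ dirS dirX Q

/-- The `∂_x` component `-⟨φ_x, η⟩ + B(φ_t, η)` of the current of a family of maps with variation
field `η`. -/
def currentX (B : TwoForm n N) (Φ : ℝ × Mink → N) (Q : ℝ × Mink) : ℝ :=
  -metricPullback g Φ dirX dirS Q + formPullback B Φ dirT dirS Q

/-- The defect `τ(φ) - Z(φ_t ∧ φ_x) - ∇V(φ)` in the Euler-Lagrange equation. -/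
def eulerLagrange (B : TwoForm n N) (V : N → ℝ) (φ : Mink → N) (p : Mink) :
    TangentSpace (𝓡 n) (φ p) :=
  waveMapOperator g φ p -
    (Z g B (φ p) (wedge (pushforward φ p dt) (pushforward φ p dx)) + gradient g V (φ p))

theorem contDiff_lagrangian {B : TwoForm n N} (hB : B.IsOfClass 1) {V : N → ℝ}
    (hV : ContMDiff (𝓡 n) 𝓘(ℝ, ℝ) 1 V) {Φ : ℝ × Mink → N}
    (hΦ : ContMDiff 𝓘(ℝ, ℝ × Mink) (𝓡 n) 2 Φ) : ContDiff ℝ 1 (lagrangian g B V Φ) := by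
  have hVΦ : ContDiff ℝ 1 (fun Q => V (Φ Q)) := (hV.comp (hΦ.of_le (by norm_num))).contDiff
  exact ((contDiff_const.mul ((contDiff_metricPullback g hΦ _ _).sub
    (contDiff_metricPullback g hΦ _ _))).add (contDiff_formPullback hB hΦ _ _)).add hVΦ

theorem contDiff_currentT {B : TwoForm n N} (hB : B.IsOfClass 1) {Φ : ℝ × Mink → N}
    (hΦ : ContMDiff 𝓘(ℝ, ℝ × Mink) (𝓡 n) 2 Φ) : ContDiff ℝ 1 (currentT g B Φ) :=
  (contDiff_metricPullback g hΦ _ _).add (contDiff_formPullback hB hΦ _ _)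

theorem contDiff_currentX {B : TwoForm n N} (hB : B.IsOfClass 1) {Φ : ℝ × Mink → N}
    (hΦ : ContMDiff 𝓘(ℝ, ℝ × Mink) (𝓡 n) 2 Φ) : ContDiff ℝ 1 (currentX g B Φ) :=
  (contDiff_metricPullback g hΦ _ _).neg.add (contDiff_formPullback hB hΦ _ _)

theorem lagrangian_eq (B : TwoForm n N) (V : N → ℝ) {Φ : ℝ × Mink → N}
    (hΦ : ContMDiff 𝓘(ℝ, ℝ × Mink) (𝓡 n) 2 Φ) (s : ℝ) (p : Mink) :
    (1 / 2) * normSqDifferential g (fun q => Φ (s, q)) p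
      + pullbackTwoForm B (fun q => Φ (s, q)) p + V (Φ (s, p)) = lagrangian g B V Φ (s, p) := by
  have hp := pushforward_eq_dirDeriv (hΦ.mdifferentiableAt (x := (s, p)) (by norm_num))
  simp only [normSqDifferential, pullbackTwoForm, Fin.sum_univ_two, hp, lagrangian, metricPullback,
    formPullback, minkFrame, minkMetric, dt, dx, dirT, dirX, Matrix.cons_val_zero,
    Matrix.cons_val_one]
  ring

/-- The first variation formula for densities: the derivative of the Lagrangian along
a variation is the divergence of a current, minus the pairing of the Euler-Lagrange defect with the
variation field. -/
theorem fderiv_lagrangian {B : TwoForm n N} (hB : B.IsOfClass 1) {V : N → ℝ}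
    (hV : ContMDiff (𝓡 n) 𝓘(ℝ, ℝ) 1 V) {Φ : ℝ × Mink → N}
    (hΦ : ContMDiff 𝓘(ℝ, ℝ × Mink) (𝓡 n) 2 Φ) (p : Mink) :
    fderiv ℝ (lagrangian g B V Φ) (0, p) dirS =
      fderiv ℝ (currentT g B Φ) (0, p) dirT + fderiv ℝ (currentX g B Φ) (0, p) dirX
        - g.inner (Φ (0, p)) (eulerLagrange g B V (fun q => Φ (0, q)) p)
            (dirDeriv Φ (0, p) dirS) := by
  set y := Φ (0, p)
  set U : ℝ × Mink → EuclideanSpace ℝ (Fin n) := fun Q => extChartAt (𝓡 n) y (Φ Q)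
  have hmd : ∀ Q, MDifferentiableAt 𝓘(ℝ, ℝ × Mink) (𝓡 n) Φ Q := fun Q =>
    hΦ.mdifferentiableAt (by norm_num)
  have hsrc : Φ (0, p) ∈ (extChartAt (𝓡 n) y).source := mem_extChartAt_source _
  have htgt := (extChartAt (𝓡 n) y).map_source hsrc
  have hU : ContDiffAt ℝ 2 U (0, p) := contDiffAt_chart_comp (r := 2) (hΦ _) hsrc
  have hη : ∀ v, (dirDeriv Φ (0, p) v : EuclideanSpace ℝ (Fin n)) = fderiv ℝ U (0, p) v :=
    dirDeriv_eq_fderiv (hmd _)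
  have hG : DifferentiableAt ℝ (metricCoord g y) (U (0, p)) :=
    (contDiffAt_metricCoord g htgt).differentiableAt (by norm_num)
  have hb : DifferentiableAt ℝ (B.coord y) (U (0, p)) :=
    (hB.contDiffAt_coord htgt).differentiableAt (by norm_num)
  -- near `(0, p)` the global pull-backs agree with their coordinate expressions in the chart at `y`
  have hm : ∀ v w, fderiv ℝ (metricPullback g Φ v w) (0, p) =
      fderiv ℝ (bilinPullback (metricCoord g y) U v w) (0, p) := fun v w =>
    (metricPullback_eventuallyEq g hΦ hsrc v w).fderiv_eq
  have hf : ∀ v w, fderiv ℝ (formPullback B Φ v w) (0, p) =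
      fderiv ℝ (bilinPullback (fun z => altToBilin (B.coord y z)) U v w) (0, p) := fun v w =>
    (formPullback_eventuallyEq B hΦ hsrc v w).fderiv_eq
  have hdm : ∀ v w, DifferentiableAt ℝ (metricPullback g Φ v w) (0, p) := fun v w =>
    (contDiff_metricPullback g hΦ v w).differentiable (by norm_num) _
  have hdf : ∀ v w, DifferentiableAt ℝ (formPullback B Φ v w) (0, p) := fun v w =>
    (contDiff_formPullback hB hΦ v w).differentiable (by norm_num) _
  have hdV : DifferentiableAt ℝ (fun Q => V (Φ Q)) (0, p) :=
    (hV.comp (hΦ.of_le (by norm_num))).contDiff.differentiable (by norm_num) _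
  have e1 : fderiv ℝ (lagrangian g B V Φ) (0, p) dirS =
      (1 / 2) * (fderiv ℝ (metricPullback g Φ dirT dirT) (0, p) dirS
        - fderiv ℝ (metricPullback g Φ dirX dirX) (0, p) dirS)
      + fderiv ℝ (formPullback B Φ dirT dirX) (0, p) dirS
      + mvfderiv (𝓡 n) V (Φ (0, p)) (dirDeriv Φ (0, p) dirS) := by
    rw [← fderiv_comp_eq_mvfderiv hV hΦ]
    have h := (((((hdm dirT dirT).hasFDerivAt.sub (hdm dirX dirX).hasFDerivAt).const_mul
      (1 / 2 : ℝ)).add (hdf dirT dirX).hasFDerivAt).add hdV.hasFDerivAt).fderiv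
    have h' : fderiv ℝ (lagrangian g B V Φ) (0, p) = _ := h
    rw [h']
    simp
  have e2 : fderiv ℝ (currentT g B Φ) (0, p) dirT =
      fderiv ℝ (metricPullback g Φ dirT dirS) (0, p) dirT
        + fderiv ℝ (formPullback B Φ dirS dirX) (0, p) dirT := by
    have h' : fderiv ℝ (currentT g B Φ) (0, p) = _ :=
      ((hdm dirT dirS).hasFDerivAt.add (hdf dirS dirX).hasFDerivAt).fderiv
    rw [h']; rfl
  have e3 : fderiv ℝ (currentX g B Φ) (0, p) dirX =
      -fderiv ℝ (metricPullback g Φ dirX dirS) (0, p) dirX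
        + fderiv ℝ (formPullback B Φ dirT dirS) (0, p) dirX := by
    have h' : fderiv ℝ (currentX g B Φ) (0, p) = _ :=
      ((hdm dirX dirS).hasFDerivAt.neg.add (hdf dirT dirS).hasFDerivAt).fderiv
    rw [h']; rfl
  have key := fderiv_lagrangian_eq hU hG (metricCoord_symm g y) hb dirT dirX dirS
  have hT := inner_pullbackCovDeriv g hΦ p dt dirS
  have hX := inner_pullbackCovDeriv g hΦ p dx dirS
  have hτ : g.inner y (waveMapOperator g (fun q => Φ (0, q)) p) (dirDeriv Φ (0, p) dirS) =
      g.inner (Φ (0, p)) (pullbackCovDeriv g (fun q => Φ (0, q))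
        (fun q => pushforward (fun q => Φ (0, q)) q dt) p dt) (dirDeriv Φ (0, p) dirS)
      - g.inner (Φ (0, p)) (pullbackCovDeriv g (fun q => Φ (0, q))
        (fun q => pushforward (fun q => Φ (0, q)) q dx) p dx) (dirDeriv Φ (0, p) dirS) := by
    have : waveMapOperator g (fun q => Φ (0, q)) p =
      pullbackCovDeriv g (fun q => Φ (0, q))
        (fun q => pushforward (fun q => Φ (0, q)) q dt) p dt
      - pullbackCovDeriv g (fun q => Φ (0, q))
        (fun q => pushforward (fun q => Φ (0, q)) q dx) p dx := by
      simp [waveMapOperator, Fin.sum_univ_two, minkFrame, minkMetric, dt, dx, sub_eq_add_neg]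
    rw [this, map_sub, sub_apply]
  have hZ : g.inner y (Z g B y (wedge (pushforward (fun q => Φ (0, q)) p dt)
      (pushforward (fun q => Φ (0, q)) p dx))) (dirDeriv Φ (0, p) dirS) =
      extDeriv (B.coord y) (U (0, p))
        ![fderiv ℝ U (0, p) dirS, fderiv ℝ U (0, p) dirT, fderiv ℝ U (0, p) dirX] := by
    refine (inner_Z g B y _ _ _).trans ?_
    rw [pushforward_eq_dirDeriv (hmd _), pushforward_eq_dirDeriv (hmd _)]
    change extDeriv (B.coord y) (U (0, p)) (chartDeriv y ∘ _) = _
    rw [chartDeriv_eq_id]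
    congr 1
    funext i
    fin_cases i
    · exact hη _
    · exact hη _
    · exact hη _
  have hgrad : g.inner y (gradient g V y) (dirDeriv Φ (0, p) dirS) =
      mvfderiv (𝓡 n) V (Φ (0, p)) (dirDeriv Φ (0, p) dirS) := inner_sharp g y _ _
  have hEL : g.inner y (eulerLagrange g B V (fun q => Φ (0, q)) p) (dirDeriv Φ (0, p) dirS) =
      g.inner y (waveMapOperator g (fun q => Φ (0, q)) p) (dirDeriv Φ (0, p) dirS)
      - (g.inner y (Z g B y (wedge (pushforward (fun q => Φ (0, q)) p dt)
          (pushforward (fun q => Φ (0, q)) p dx))) (dirDeriv Φ (0, p) dirS)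
        + g.inner y (gradient g V y) (dirDeriv Φ (0, p) dirS)) := by
    rw [eulerLagrange, map_sub, sub_apply, map_add, add_apply]
  rw [hEL, hτ, hZ, hgrad, hT, hX, e1, e2, e3]
  simp only [hm, hf]
  simp only [dirT, dirX] at key ⊢
  linarith

end FirstVariation

/-! ### Integrals of derivatives over compact sets -/

section Integration

/-- Differentiation under the integral sign, over a compact set. -/
theorem hasDerivAt_setIntegral_of_contDiff {f : ℝ × Mink → ℝ} (hf : ContDiff ℝ 1 f)
    {K : Set Mink} (hK : IsCompact K) :
    HasDerivAt (fun s : ℝ => ∫ p in K, f (s, p)) (∫ p in K, fderiv ℝ f (0, p) dirS) 0 := by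
  have hf' : Continuous (fun Q => fderiv ℝ f Q dirS) :=
    (hf.continuous_fderiv (by norm_num)).clm_apply continuous_const
  obtain ⟨C, hC⟩ := ((isCompact_Icc (a := (-1 : ℝ)) (b := 1)).prod hK).exists_bound_of_continuousOn
    hf'.continuousOn
  have hfin : IsFiniteMeasure (volume.restrict K) := ⟨by
    rw [Measure.restrict_apply_univ]; exact hK.measure_lt_top⟩
  have hs : Ioo (-1 : ℝ) 1 ∈ 𝓝 (0 : ℝ) := Ioo_mem_nhds (by norm_num) (by norm_num)
  refine (hasDerivAt_integral_of_dominated_loc_of_deriv_le (μ := volume.restrict K)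
    (F := fun s p => f (s, p)) (F' := fun s p => fderiv ℝ f (s, p) dirS) (bound := fun _ => C)
    hs ?_ ?_ ?_ ?_ (integrable_const C) ?_).2
  · exact Eventually.of_forall fun s =>
      (hf.continuous.comp (by fun_prop : Continuous fun p : Mink => (s, p))).aestronglyMeasurable
  · exact (hf.continuous.comp
      (by fun_prop : Continuous fun p : Mink => ((0 : ℝ), p))).continuousOn.integrableOn_compact hK
  · exact (hf'.comp (by fun_prop : Continuous fun p : Mink => ((0 : ℝ), p))).aestronglyMeasurable
  · filter_upwards [ae_restrict_mem hK.measurableSet] with p hp s hs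
    exact hC (s, p) ⟨Ioo_subset_Icc_self hs, hp⟩
  · refine Eventually.of_forall fun p s _ => ?_
    have h1 : HasDerivAt (fun s : ℝ => (s, p)) dirS s :=
      (hasDerivAt_id s).prodMk (hasDerivAt_const s p)
    exact ((hf.differentiable (by norm_num) (s, p)).hasFDerivAt).comp_hasDerivAt s h1

/-- The integral of a derivative of a compactly supported function vanishes. -/
theorem setIntegral_fderiv_eq_zero {h : Mink → ℝ} (hh : ContDiff ℝ 1 h) {K : Set Mink}
    (hK : IsCompact K) (h0 : ∀ p ∉ K, h p = 0) (e : Mink) :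
    ∫ p in K, fderiv ℝ h p e = 0 := by
  have hsupp : HasCompactSupport h := HasCompactSupport.intro hK h0
  have hz : ∀ p ∉ K, fderiv ℝ h p e = 0 := by
    intro p hp
    have : h =ᶠ[𝓝 p] fun _ => 0 := by
      filter_upwards [hK.isClosed.isOpen_compl.mem_nhds hp] with q hq using h0 q hq
    rw [this.fderiv_eq]; simp
  rw [setIntegral_eq_integral_of_forall_compl_eq_zero hz]
  have hint : Integrable (fun p => fderiv ℝ h p e) :=
    ((hh.continuous_fderiv (by norm_num)).clm_apply
      continuous_const).integrable_of_hasCompactSupport (HasCompactSupport.intro hK hz)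
  have := integral_mul_fderiv_eq_neg_fderiv_mul_of_integrable (μ := (volume : Measure Mink))
    (f := fun _ => (1 : ℝ)) (g := h) (v := e) (by simp) (by simpa using hint)
    (by simpa using hh.continuous.integrable_of_hasCompactSupport hsupp)
    (fun _ _ => differentiableAt_const _) (fun p _ => hh.differentiable (by norm_num) p)
  simpa using this

end Integration

/-! ### The first variation of the action -/

section Action

variable {n : ℕ} {N : Type*} [TopologicalSpace N] [ChartedSpace (EuclideanSpace ℝ (Fin n)) N]

/-- The variation field of a family of maps is the velocity of its curves `s ↦ Φ (s, p)`. -/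
theorem dirDeriv_dirS_eq_mfderiv {Φ : ℝ × Mink → N} {s : ℝ} {p : Mink}
    (hΦ : MDifferentiableAt 𝓘(ℝ, ℝ × Mink) (𝓡 n) Φ (s, p)) :
    (dirDeriv Φ (s, p) dirS : EuclideanSpace ℝ (Fin n)) =
      (mfderiv 𝓘(ℝ, ℝ) (𝓡 n) (fun r => Φ (r, p)) s : ℝ →L[ℝ] EuclideanSpace ℝ (Fin n)) 1 := by
  have hι : HasFDerivAt (fun r : ℝ => (r, p)) (ContinuousLinearMap.inl ℝ ℝ Mink) s :=
    hasFDerivAt_prodMk_left s p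
  have h := mfderiv_comp (I := 𝓘(ℝ, ℝ)) (I' := 𝓘(ℝ, ℝ × Mink)) s hΦ
    hι.hasMFDerivAt.mdifferentiableAt
  rw [hι.hasMFDerivAt.mfderiv] at h
  change _ = (mfderiv 𝓘(ℝ, ℝ) (𝓡 n) (Φ ∘ fun r => (r, p)) s :
    ℝ →L[ℝ] EuclideanSpace ℝ (Fin n)) 1
  rw [h]
  rfl

theorem dirDeriv_dirS_eq_zero {Φ : ℝ × Mink → N} {p : Mink}
    (hΦ : MDifferentiableAt 𝓘(ℝ, ℝ × Mink) (𝓡 n) Φ (0, p)) {y : N} (h : ∀ s, Φ (s, p) = y) :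
    dirDeriv (n := n) Φ (0, p) dirS = 0 := by
  refine (dirDeriv_dirS_eq_mfderiv hΦ).trans ?_
  have : (fun r => Φ (r, p)) = fun _ => y := funext h
  rw [this, mfderiv_const]
  rfl

variable [IsManifold (𝓡 n) ∞ N]
  (g : Bundle.ContMDiffRiemannianMetric (𝓡 n) ∞ (EuclideanSpace ℝ (Fin n))
      (fun y : N => TangentSpace (𝓡 n) y))

/-- The pairing of the Euler-Lagrange defect of `φ` with the variation field of a family `Φ` through
`φ`. -/
def eulerLagrangePairing (B : TwoForm n N) (V : N → ℝ) (φ : Mink → N) (Φ : ℝ × Mink → N)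
    (p : Mink) : ℝ :=
  g.inner (φ p) (eulerLagrange g B V φ p)
    (dirDeriv Φ (0, p) dirS : EuclideanSpace ℝ (Fin n))

variable {g} {B : TwoForm n N} {V : N → ℝ} {φ : Mink → N} {Φ : ℝ × Mink → N}

theorem eulerLagrangePairing_eq (hB : B.IsOfClass 1) (hV : ContMDiff (𝓡 n) 𝓘(ℝ, ℝ) 1 V)
    (hΦ : ContMDiff 𝓘(ℝ, ℝ × Mink) (𝓡 n) 2 Φ) (h0 : ∀ p, Φ (0, p) = φ p) (p : Mink) :
    eulerLagrangePairing g B V φ Φ p =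
      fderiv ℝ (currentT g B Φ) (0, p) dirT + fderiv ℝ (currentX g B Φ) (0, p) dirX
        - fderiv ℝ (lagrangian g B V Φ) (0, p) dirS := by
  obtain rfl : (fun p => Φ (0, p)) = φ := funext h0
  rw [fderiv_lagrangian g hB hV hΦ p]
  simp [eulerLagrangePairing]

theorem continuous_eulerLagrangePairing (hB : B.IsOfClass 1) (hV : ContMDiff (𝓡 n) 𝓘(ℝ, ℝ) 1 V)
    (hΦ : ContMDiff 𝓘(ℝ, ℝ × Mink) (𝓡 n) 2 Φ) (h0 : ∀ p, Φ (0, p) = φ p) :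
    Continuous (eulerLagrangePairing g B V φ Φ) := by
  have hc : ∀ {f : ℝ × Mink → ℝ}, ContDiff ℝ 1 f → ∀ e,
      Continuous fun p : Mink => fderiv ℝ f (0, p) e := fun hf e =>
    ((hf.continuous_fderiv (by norm_num)).comp (by fun_prop)).clm_apply continuous_const
  rw [funext (eulerLagrangePairing_eq hB hV hΦ h0)]
  exact ((hc (contDiff_currentT g hB hΦ) _).add (hc (contDiff_currentX g hB hΦ) _)).sub
    (hc (contDiff_lagrangian g hB hV hΦ) _)

theorem eulerLagrangePairing_eq_zero_of_notMem
    (hΦ : ContMDiff 𝓘(ℝ, ℝ × Mink) (𝓡 n) 2 Φ) {p : Mink} (hp : ∀ s, Φ (s, p) = φ p) :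
    eulerLagrangePairing g B V φ Φ p = 0 := by
  rw [eulerLagrangePairing,
    dirDeriv_dirS_eq_zero (hΦ.mdifferentiableAt (by norm_num)) hp]
  exact map_zero _

/-- The first variation formula for the action. -/
theorem hasDerivAt_action (hB : B.IsOfClass 1) (hV : ContMDiff (𝓡 n) 𝓘(ℝ, ℝ) 1 V)
    (hΦ : ContMDiff 𝓘(ℝ, ℝ × Mink) (𝓡 n) 2 Φ) (h0 : ∀ p, Φ (0, p) = φ p)
    {K : Set Mink} (hK : IsCompact K) (hΦK : ∀ s, ∀ p, p ∉ K → Φ (s, p) = φ p) :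
    HasDerivAt (fun s : ℝ => action g B V K (fun p => Φ (s, p)))
      (-∫ p, eulerLagrangePairing g B V φ Φ p) 0 := by
  have hL := contDiff_lagrangian g hB hV hΦ
  have hT := contDiff_currentT g hB hΦ
  have hX := contDiff_currentX g hB hΦ
  have hmain := hasDerivAt_setIntegral_of_contDiff hL hK
  have hact : (fun s : ℝ => action g B V K (fun p => Φ (s, p))) =
      fun s => ∫ p in K, lagrangian g B V Φ (s, p) := by
    funext s
    simp only [action, lagrangian_eq g B V hΦ]
  rw [hact]
  convert hmain using 1
  have hη : ∀ p ∉ K, dirDeriv (n := n) Φ (0, p) dirS = 0 := fun p hp =>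
    dirDeriv_dirS_eq_zero (hΦ.mdifferentiableAt (by norm_num)) fun s => hΦK s p hp
  have hz : ∀ p ∉ K, eulerLagrangePairing g B V φ Φ p = 0 := fun p hp =>
    eulerLagrangePairing_eq_zero_of_notMem hΦ fun s => hΦK s p hp
  have hT0 : ∀ p ∉ K, currentT g B Φ (0, p) = 0 := by
    intro p hp
    simp only [currentT, metricPullback, formPullback, hη p hp, map_zero, zero_add]
    exact (B _).map_coord_zero 0 rfl
  have hX0 : ∀ p ∉ K, currentX g B Φ (0, p) = 0 := by
    intro p hp
    simp only [currentX, metricPullback, formPullback, hη p hp, map_zero, neg_zero, zero_add]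
    exact (B _).map_coord_zero 1 rfl
  have hslice : Continuous fun p : Mink => ((0 : ℝ), p) := by fun_prop
  have hsl : ContDiff ℝ 1 fun p : Mink => ((0 : ℝ), p) := contDiff_const.prodMk contDiff_id
  have iT : ∫ p in K, fderiv ℝ (currentT g B Φ) (0, p) dirT = 0 := by
    refine Eq.trans ?_ (setIntegral_fderiv_eq_zero (hT.comp hsl) hK hT0 dt)
    refine integral_congr_ae (Eventually.of_forall fun p => ?_)
    exact (fderiv_slice (hT.differentiable (by norm_num) _) dt).symm
  have iX : ∫ p in K, fderiv ℝ (currentX g B Φ) (0, p) dirX = 0 := by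
    refine Eq.trans ?_ (setIntegral_fderiv_eq_zero (hX.comp hsl) hK hX0 dx)
    refine integral_congr_ae (Eventually.of_forall fun p => ?_)
    exact (fderiv_slice (hX.differentiable (by norm_num) _) dx).symm
  have hint : ∀ {f : ℝ × Mink → ℝ}, ContDiff ℝ 1 f → ∀ e,
      IntegrableOn (fun p : Mink => fderiv ℝ f (0, p) e) K := fun hf e =>
    (((hf.continuous_fderiv (by norm_num)).comp hslice).clm_apply
      continuous_const).continuousOn.integrableOn_compact hK
  rw [← setIntegral_eq_integral_of_forall_compl_eq_zero hz]
  simp only [eulerLagrangePairing_eq hB hV hΦ h0]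
  have hTX : IntegrableOn (fun p : Mink => fderiv ℝ (currentT g B Φ) (0, p) dirT
      + fderiv ℝ (currentX g B Φ) (0, p) dirX) K := (hint hT dirT).add (hint hX dirX)
  rw [integral_sub hTX (hint hL _),
    integral_add (hint hT _) (hint hX _), iT, iX]
  simp

end Action

/-! ### Construction of variations -/

section Variations

variable {n : ℕ} {N : Type*} [TopologicalSpace N] [ChartedSpace (EuclideanSpace ℝ (Fin n)) N]

/-- Rescaling the parameter of a family by a function `χ` on Minkowski space multiplies the
variation field by `χ`. -/
theorem dirDeriv_reparam {Φ : ℝ × Mink → N} {r : ℕ∞} (hr : 1 ≤ r)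
    (hΦ : ContMDiff 𝓘(ℝ, ℝ × Mink) (𝓡 n) r Φ) {χ : Mink → ℝ} (hχ : ContDiff ℝ ∞ χ) :
    ContMDiff 𝓘(ℝ, ℝ × Mink) (𝓡 n) r (fun Q : ℝ × Mink => Φ (χ Q.2 * Q.1, Q.2)) ∧
    ∀ p, (dirDeriv (fun Q : ℝ × Mink => Φ (χ Q.2 * Q.1, Q.2)) (0, p) dirS :
        EuclideanSpace ℝ (Fin n)) = χ p • (dirDeriv Φ (0, p) dirS : EuclideanSpace ℝ (Fin n)) := by
  have hr' : (r : WithTop ℕ∞) ≠ 0 := by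
    have : r ≠ 0 := by rintro rfl; simp at hr
    exact_mod_cast this
  have hR : ContDiff ℝ r (fun Q : ℝ × Mink => (χ Q.2 * Q.1, Q.2)) :=
    (((hχ.of_le (by exact_mod_cast le_top)).comp contDiff_snd).mul contDiff_fst).prodMk contDiff_snd
  have hC := hΦ.comp hR.contMDiff
  refine ⟨hC, fun p => ?_⟩
  refine (dirDeriv_dirS_eq_mfderiv (hC.mdifferentiableAt hr')).trans ?_
  have hl : HasFDerivAt (fun s : ℝ => χ p * s) (χ p • ContinuousLinearMap.id ℝ ℝ) 0 := by
    simpa using (hasFDerivAt_id (𝕜 := ℝ) (0 : ℝ)).const_mul (χ p)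
  have hc : MDifferentiableAt 𝓘(ℝ, ℝ) (𝓡 n) (fun s : ℝ => Φ (s, p)) (χ p * 0) :=
    (hΦ.comp (contDiff_id.prodMk contDiff_const : ContDiff ℝ r fun s : ℝ => (s, p)).contMDiff
      ).mdifferentiableAt hr'
  have h := mfderiv_comp (I := 𝓘(ℝ, ℝ)) (I' := 𝓘(ℝ, ℝ)) (0 : ℝ) hc hl.hasMFDerivAt.mdifferentiableAt
  rw [hl.hasMFDerivAt.mfderiv] at h
  have e := dirDeriv_dirS_eq_mfderiv (hΦ.mdifferentiableAt (x := (0, p)) hr')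
  rw [e]
  change (mfderiv 𝓘(ℝ, ℝ) (𝓡 n) ((fun s => Φ (s, p)) ∘ fun s => χ p * s) 0 :
    ℝ →L[ℝ] EuclideanSpace ℝ (Fin n)) 1 = _
  rw [h]
  have h0 : χ p * (0 : ℝ) = 0 := mul_zero _
  rw [h0]
  change (mfderiv 𝓘(ℝ, ℝ) (𝓡 n) (fun s => Φ (s, p)) 0 :
    ℝ →L[ℝ] EuclideanSpace ℝ (Fin n)) (χ p • 1) = _
  rw [map_smul]

variable [IsManifold (𝓡 n) ∞ N]

/-- Every tangent vector at `φ p₀` is, up to a nonzero factor, the value at `p₀` of the variation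
field of a compactly supported variation of `φ`. -/
theorem exists_variation {k : ℕ∞} (hk : 1 ≤ k) {φ : Mink → N}
    (hφ : ContMDiff 𝓘(ℝ, Mink) (𝓡 n) k φ) (p₀ : Mink) (w : EuclideanSpace ℝ (Fin n)) :
    ∃ Φ : ℝ × Mink → N, ContMDiff 𝓘(ℝ, ℝ × Mink) (𝓡 n) k Φ ∧ (∀ p, Φ (0, p) = φ p) ∧
      (∃ K : Set Mink, IsCompact K ∧ ∀ s, ∀ p, p ∉ K → Φ (s, p) = φ p) ∧
      ∃ c : ℝ, c ≠ 0 ∧ (dirDeriv Φ (0, p₀) dirS : EuclideanSpace ℝ (Fin n)) = c • w := by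
  have : IsManifold (𝓡 n) k N := IsManifold.of_le (n := ∞) (by exact_mod_cast le_top)
  have hk' : (k : WithTop ℕ∞) ≠ 0 := by
    have : k ≠ 0 := by rintro rfl; simp at hk
    exact_mod_cast this
  set y := φ p₀
  set u : Mink → EuclideanSpace ℝ (Fin n) := fun p => extChartAt (𝓡 n) y (φ p)
  have hsrc0 : φ p₀ ∈ (extChartAt (𝓡 n) y).source := mem_extChartAt_source _
  have hsrc : ∀ᶠ p in 𝓝 p₀, φ p ∈ (extChartAt (𝓡 n) y).source :=
    eventually_mem_chart hφ.continuous.continuousAt hsrc0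
  have hucont : ContinuousAt u p₀ := (contDiffAt_chart_comp (hφ p₀) hsrc0).continuousAt
  -- for small parameters and close to `p₀`, the perturbed map stays in the chart
  have htgt : ∀ᶠ Q : ℝ × Mink in 𝓝 (0, p₀), u Q.2 + Q.1 • w ∈ (extChartAt (𝓡 n) y).target := by
    have hc : ContinuousAt (fun Q : ℝ × Mink => u Q.2 + Q.1 • w) (0, p₀) :=
      (ContinuousAt.comp (x := ((0 : ℝ), p₀)) (f := Prod.snd) hucont continuousAt_snd).add
        (continuousAt_fst.smul continuousAt_const)
    refine hc.eventually ((isOpen_extChartAt_target y).mem_nhds ?_)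
    simpa [u] using (extChartAt (𝓡 n) y).map_source hsrc0
  have hsrc' : ∀ᶠ Q : ℝ × Mink in 𝓝 (0, p₀), φ Q.2 ∈ (extChartAt (𝓡 n) y).source :=
    (continuousAt_snd (p := ((0 : ℝ), p₀))).eventually hsrc
  obtain ⟨ε, hε, hball⟩ := Metric.eventually_nhds_iff.1 (htgt.and hsrc')
  have hmem : ∀ p ∈ Metric.ball p₀ ε, φ p ∈ (extChartAt (𝓡 n) y).source ∧
      ∀ a : ℝ, |a| < ε → u p + a • w ∈ (extChartAt (𝓡 n) y).target := by
    intro p hp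
    refine ⟨(hball (y := (0, p)) ?_).2, fun a ha => (hball (y := (a, p)) ?_).1⟩
    · simpa [Prod.dist_eq, hε] using hp
    · simpa [Prod.dist_eq, ha] using hp
  let ψ : ContDiffBump p₀ := ⟨ε / 4, ε / 2, by positivity, by linarith⟩
  -- the sine keeps the perturbation small for all values of the parameter
  let a : ℝ × Mink → ℝ := fun Q => ε / 2 * Real.sin Q.1 * ψ Q.2
  have ha : ContDiff ℝ k a :=
    (contDiff_const.mul (Real.contDiff_sin.comp contDiff_fst)).mul (ψ.contDiff.comp contDiff_snd)
  have ha_lt : ∀ Q, |a Q| < ε := by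
    intro Q
    have h1 := Real.abs_sin_le_one Q.1
    have h2 : |ψ Q.2| ≤ 1 := by rw [abs_of_nonneg ψ.nonneg]; exact ψ.le_one
    have h3 : |Real.sin Q.1| * |ψ Q.2| ≤ 1 := mul_le_one₀ h1 (abs_nonneg _) h2
    have h4 : |a Q| = ε / 2 * (|Real.sin Q.1| * |ψ Q.2|) := by
      simp only [a, abs_mul]
      rw [abs_of_pos (half_pos hε), mul_assoc]
    rw [h4]
    nlinarith
  classical
  let Φ : ℝ × Mink → N := fun Q =>
    if Q.2 ∈ Metric.ball p₀ ε then (extChartAt (𝓡 n) y).symm (u Q.2 + a Q • w) else φ Q.2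
  have hΦ_in : ∀ Q : ℝ × Mink, Q.2 ∈ Metric.ball p₀ ε →
      Φ Q = (extChartAt (𝓡 n) y).symm (u Q.2 + a Q • w) := fun Q hQ => if_pos hQ
  have hΦ_zero : ∀ Q : ℝ × Mink, a Q = 0 → Φ Q = φ Q.2 := by
    intro Q hQ
    by_cases h : Q.2 ∈ Metric.ball p₀ ε
    · rw [hΦ_in Q h, hQ, zero_smul, add_zero]
      exact (extChartAt (𝓡 n) y).left_inv (hmem _ h).1
    · exact if_neg h
  have hψ : ∀ p, p ∉ Metric.closedBall p₀ (ε / 2) → ψ p = 0 := by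
    intro p hp
    refine ψ.zero_of_le_dist ?_
    rw [Metric.mem_closedBall, not_le] at hp
    exact hp.le
  have hopen : ∀ Q : ℝ × Mink, Q.2 ∈ Metric.ball p₀ ε → ∀ᶠ Q' in 𝓝 Q, Q'.2 ∈ Metric.ball p₀ ε :=
    fun Q hQ => continuousAt_snd.eventually (Metric.isOpen_ball.mem_nhds hQ)
  have hin : ∀ Q : ℝ × Mink, Q.2 ∈ Metric.ball p₀ ε →
      ContDiffAt ℝ k (fun Q : ℝ × Mink => u Q.2 + a Q • w) Q := by
    intro Q hQ
    have hu' : ContDiffAt ℝ k u Q.2 := contDiffAt_chart_comp (hφ _) (hmem _ hQ).1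
    exact (hu'.comp Q contDiffAt_snd).add (ha.contDiffAt.smul contDiffAt_const)
  have hΦ : ContMDiff 𝓘(ℝ, ℝ × Mink) (𝓡 n) k Φ := by
    intro Q
    by_cases hQ : Q.2 ∈ Metric.ball p₀ ε
    · have hs : ContMDiffAt 𝓘(ℝ, EuclideanSpace ℝ (Fin n)) (𝓡 n) k (extChartAt (𝓡 n) y).symm
          (u Q.2 + a Q • w) :=
        (contMDiffOn_extChartAt_symm y).contMDiffAt
          ((isOpen_extChartAt_target y).mem_nhds ((hmem _ hQ).2 _ (ha_lt Q)))
      refine ContMDiffAt.congr_of_eventuallyEq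
        (ContMDiffAt.comp Q hs (hin Q hQ).contMDiffAt) ?_
      filter_upwards [hopen Q hQ] with Q' hQ' using hΦ_in Q' hQ'
    · have hsnd : ContMDiff 𝓘(ℝ, ℝ × Mink) 𝓘(ℝ, Mink) k (Prod.snd : ℝ × Mink → Mink) :=
        contDiff_snd.contMDiff
      refine ContMDiffAt.congr_of_eventuallyEq ((hφ.comp hsnd) Q) ?_
      have hfar : Q.2 ∈ (Metric.closedBall p₀ (ε / 2))ᶜ := fun h =>
        hQ (Metric.closedBall_subset_ball (by linarith) h)
      filter_upwards [continuousAt_snd.eventually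
        (Metric.isClosed_closedBall.isOpen_compl.mem_nhds hfar)] with Q' hQ'
      exact hΦ_zero Q' (by simp [a, hψ _ hQ'])
  refine ⟨Φ, hΦ, fun p => hΦ_zero (0, p) (by simp [a]),
    ⟨Metric.closedBall p₀ (ε / 2), isCompact_closedBall _ _, fun s p hp =>
      hΦ_zero (s, p) (by simp [a, hψ _ hp])⟩, ε / 2, (half_pos hε).ne', ?_⟩
  have hp₀ : p₀ ∈ Metric.ball p₀ ε := Metric.mem_ball_self hε
  have hΦ0 : Φ (0, p₀) = y := hΦ_zero (0, p₀) (by simp [a])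
  refine (dirDeriv_eq_fderiv (hΦ.mdifferentiableAt hk') dirS).trans ?_
  rw [hΦ0]
  have hev : (fun Q => extChartAt (𝓡 n) y (Φ Q)) =ᶠ[𝓝 (0, p₀)] fun Q => u Q.2 + a Q • w := by
    filter_upwards [hopen (0, p₀) hp₀] with Q hQ
    rw [hΦ_in Q hQ]
    exact (extChartAt (𝓡 n) y).right_inv ((hmem _ hQ).2 _ (ha_lt Q))
  rw [hev.fderiv_eq]
  have hd := ((hin (0, p₀) hp₀).differentiableAt hk').hasFDerivAt.comp_hasDerivAt (0 : ℝ)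
    ((hasDerivAt_id (0 : ℝ)).prodMk (hasDerivAt_const (0 : ℝ) p₀))
  have hψ1 : ψ p₀ = 1 := ψ.one_of_mem_closedBall (Metric.mem_closedBall_self ψ.rIn_pos.le)
  have hsin : HasDerivAt (fun s : ℝ => u p₀ + (ε / 2 * Real.sin s * ψ p₀) • w) ((ε / 2) • w) 0 := by
    have h := ((((Real.hasDerivAt_sin 0).const_mul (ε / 2)).mul_const (ψ p₀)).smul_const
      w).const_add (u p₀)
    simpa [hψ1] using h
  exact hd.unique hsin

end Variations

/-! ### The Euler-Lagrange equation -/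

section Equivalence

variable {n : ℕ} {N : Type*} [TopologicalSpace N] [ChartedSpace (EuclideanSpace ℝ (Fin n)) N]
  [IsManifold (𝓡 n) ∞ N]
  {g : Bundle.ContMDiffRiemannianMetric (𝓡 n) ∞ (EuclideanSpace ℝ (Fin n))
      (fun y : N => TangentSpace (𝓡 n) y)}
  {B : TwoForm n N} {V : N → ℝ} {φ : Mink → N} {k : ℕ∞}

/-- The Euler-Lagrange defect of a critical point is orthogonal to the variation field of every
compactly supported variation. -/
theorem IsCriticalPoint.eulerLagrangePairing_eq_zero (hB : B.IsOfClass 1)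
    (hV : ContMDiff (𝓡 n) 𝓘(ℝ, ℝ) 1 V) (hk : 2 ≤ k) (hcrit : IsCriticalPoint g k B V φ)
    {Φ : ℝ × Mink → N} (hΦ : ContMDiff 𝓘(ℝ, ℝ × Mink) (𝓡 n) k Φ) (h0 : ∀ p, Φ (0, p) = φ p)
    {K : Set Mink} (hK : IsCompact K) (hΦK : ∀ s, ∀ p, p ∉ K → Φ (s, p) = φ p) (p : Mink) :
    eulerLagrangePairing g B V φ Φ p = 0 := by
  have hk2 : ((2 : ℕ∞) : WithTop ℕ∞) ≤ k := by exact_mod_cast hk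
  have hcont : Continuous (eulerLagrangePairing g B V φ Φ) :=
    continuous_eulerLagrangePairing hB hV (hΦ.of_le hk2) h0
  have hae : ∀ᵐ q ∂(volume : Measure Mink), eulerLagrangePairing g B V φ Φ q = 0 := by
    refine ae_eq_zero_of_integral_contDiff_smul_eq_zero hcont.locallyIntegrable fun χ hχ _ => ?_
    obtain ⟨hΨ, hη⟩ := dirDeriv_reparam (le_trans (by norm_num) hk) hΦ hχ
    set Ψ : ℝ × Mink → N := fun Q => Φ (χ Q.2 * Q.1, Q.2)
    have hΨ0 : ∀ p, Ψ (0, p) = φ p := fun p => by simp [Ψ, h0]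
    have hΨK : ∀ s, ∀ p, p ∉ K → Ψ (s, p) = φ p := fun s p hp => hΦK _ p hp
    have h1 := hasDerivAt_action (g := g) hB hV (hΨ.of_le hk2) hΨ0 hK hΨK
    have h2 := (hcrit Ψ hΨ hΨ0 K hK hΨK).unique h1
    have h3 : ∀ q, eulerLagrangePairing g B V φ Ψ q = χ q • eulerLagrangePairing g B V φ Φ q := by
      intro q
      rw [eulerLagrangePairing, hη q]
      exact (g.inner (φ q) (eulerLagrange g B V φ q)).map_smul (χ q) _
    rw [← integral_congr_ae (Eventually.of_forall h3)]
    linarith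
  exact congrFun ((hcont.ae_eq_iff_eq volume continuous_const).1 hae) p

theorem isCriticalPoint_iff_eulerLagrange_eq_zero (hB : B.IsOfClass 1)
    (hV : ContMDiff (𝓡 n) 𝓘(ℝ, ℝ) 1 V) (hk : 2 ≤ k) (hφ : ContMDiff 𝓘(ℝ, Mink) (𝓡 n) k φ) :
    IsCriticalPoint g k B V φ ↔ ∀ p, eulerLagrange g B V φ p = 0 := by
  have hk2 : ((2 : ℕ∞) : WithTop ℕ∞) ≤ k := by exact_mod_cast hk
  constructor
  · intro hcrit p
    by_contra hne
    obtain ⟨Φ, hΦ, h0, ⟨K, hK, hΦK⟩, c, hc, hη⟩ :=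
      exists_variation (le_trans (by norm_num) hk) hφ p (eulerLagrange g B V φ p)
    have h := hcrit.eulerLagrangePairing_eq_zero hB hV hk hΦ h0 hK hΦK p
    rw [eulerLagrangePairing, hη] at h
    have h' : c * g.inner (φ p) (eulerLagrange g B V φ p) (eulerLagrange g B V φ p) = 0 :=
      ((g.inner (φ p) (eulerLagrange g B V φ p)).map_smul c _).symm.trans h
    exact (mul_ne_zero hc (g.pos _ _ hne).ne') h'
  · intro hEL Φ hΦ h0 K hK hΦK
    have h := hasDerivAt_action (g := g) hB hV (hΦ.of_le hk2) h0 hK hΦK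
    have hz : eulerLagrangePairing g B V φ Φ = fun _ => 0 := by
      funext p
      rw [eulerLagrangePairing, hEL p, map_zero]; rfl
    simpa [hz] using h

end Equivalence

end StringAction

end

theorem mainTheorem7 {n : ℕ} {N : Type*} [TopologicalSpace N] [T2Space N]
    [SecondCountableTopology N] [ChartedSpace (EuclideanSpace ℝ (Fin n)) N]
    [IsManifold (𝓡 n) ∞ N]
    (g : Bundle.ContMDiffRiemannianMetric (𝓡 n) ∞ (EuclideanSpace ℝ (Fin n))
      (fun y : N => TangentSpace (𝓡 n) y))
    (B : StringAction.TwoForm n N) (hB : B.IsOfClass 1)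
    (V : N → ℝ) (hV : ContMDiff (𝓡 n) 𝓘(ℝ, ℝ) 1 V)
    (k : ℕ∞) (hk : 2 ≤ k)
    (φ : StringAction.Mink → N) (hφ : ContMDiff 𝓘(ℝ, StringAction.Mink) (𝓡 n) k φ) :
    StringAction.IsCriticalPoint g k B V φ ↔
      ∀ p, StringAction.waveMapOperator g φ p =
        StringAction.Z g B (φ p)
            (StringAction.wedge (StringAction.pushforward φ p StringAction.dt)
              (StringAction.pushforward φ p StringAction.dx))
          + StringAction.gradient g V (φ p) := by
  rw [StringAction.isCriticalPoint_iff_eulerLagrange_eq_zero hB hV hk hφ]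
  exact forall_congr' fun p => sub_eq_zero
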